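/- Let $n, p$ be natural numbers, let $X$ be a real $n \times p$ matrix and $y \in \mathbb{R}^n$, and let $a, b, c, a', b' > 0$. Let $$\pi_\tau(t) = \frac{1}{C(a,b,c)} \frac{t^{a-1}}{(c+t)^{a+b}}, \quad t > 0, \qquad C(a,b,c) = \int_0^\infty \frac{t^{a-1}}{(c+t)^{a+b}}\,dt .$$ Write $\mathrm{IG}(\alpha, r)$ for the inverse gamma distribution with density $\frac{r^\alpha}{\Gamma(\alpha)} x^{-1-\alpha} e^{-r/x}$ on $(0,\infty)$. Consider the Markov chain on $(0,\infty)^p$ which moves from $v = (v_k)_{k=1}^p$ to $\tilde v = (\tilde v_k)_{k=1}^p$ by the following two-stage Gibbs sampler, where $\Psi = \mathrm{diag}(1/v_1, \dots, 1/v_p)$. 1. Draw $\sigma^2 \sim \mathrm{IG}\big(n/2 + a', \{\|y\|^2 - y^\top X (X^\top X + \Psi)^{-1} X^\top y\}/2 + b'\big)$ and then, given $\sigma^2$, draw $\beta \sim \mathrm{N}_p\big((X^\top X + \Psi)^{-1} X^\top y,\ \sigma^2 (X^\top X + \Psi)^{-1}\big)$. Independently of $(\beta, \sigma^2)$, draw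 $\tau^2$ from the density on $(0, \infty)$ proportional to $\pi_\tau(t) \prod_{k=1}^p \frac{t^{1/2}}{v_k + t}$ and then, given $\tau^2$, draw independently $\nu_k \sim \mathrm{IG}(1, 1 + \tau^2 / v_k)$, $k = 1, \dots, p$. 2. Given $(\beta, \sigma^2, \nu, \tau^2)$, draw independently $\tilde v_k \sim \mathrm{IG}\big(1, \beta_k^2/(2\sigma^2) + \tau^2/\nu_k\big)$, $k = 1, \dots, p$. For $V \colon (0,\infty)^p \to [0,\infty)$ let $(PV)(v) = E[\,E[V(\tilde v) \mid \beta, \sigma^2, \nu, \tau^2] \mid v\,] \in [0, \infty]$, and for $\varepsilon > 0$ let $V_{2,\varepsilon}(v) = \sum_{k=1}^p v_k^{-\varepsilon}$. Assume that $a$ is not a natural number if $p$ is even, that $a$ is not of the form $m - 1/2$ with $m$ a natural number if $p$ is odd, and that $$a + 1 < \frac{2 \log 2 - 1}{2}\, p .$$ Then there exists $0 < \varepsilon_0 < 1/2$ such that for no $\varepsilon_1 \in (0, \varepsilon_0)$ do there exist $0 < \delta < 1$ and $\Delta > 0$ with $$(P V_{2,\varepsilon_1})(v) \le \Delta + \delta\,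 V_{2,\varepsilon_1}(v) \quad \text{for all } v \in (0,\infty)^p .$$ -/

import Mathlib

open MeasureTheory ProbabilityTheory
open scoped ENNReal Matrix

namespace HorseshoeGibbs

noncomputable section

/-- The inverse gamma distribution `IG(α, r)` on `(0, ∞)`, with density
`r ^ α / Γ(α) * x ^ (-1 - α) * exp (-r / x)`: the law of `1 / ξ` where `ξ` has the gamma
distribution with shape `α` and rate `r`. -/
def invGammaLaw (α r : ℝ) : Measure ℝ :=
  (gammaMeasure α r).map (fun x => x⁻¹)

/-- The (scaled) three-parameter beta prior density of `τ²`,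
`t ^ (a - 1) / (c + t) ^ (a + b)` divided by its integral over `(0, ∞)`. -/
def priorTau (a b c t : ℝ) : ℝ :=
  (t ^ (a - 1) / (c + t) ^ (a + b)) /
    ∫ s in Set.Ioi (0 : ℝ), s ^ (a - 1) / (c + s) ^ (a + b)

/-- The unnormalised conditional density `f(t; v) = π(t) * ∏ k, t ^ (1 / 2) / (v k + t)` of `τ²`
given that the vector of local scales is `v`. -/
def condTauDensity {p : ℕ} (a b c : ℝ) (v : Fin p → ℝ) (t : ℝ) : ℝ :=
  priorTau a b c t * ∏ k, t ^ (1 / 2 : ℝ) / (v k + t)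

/-- The conditional law of `τ²` given that the vector of local scales is `v`. -/
def tauLaw {p : ℕ} (a b c : ℝ) (v : Fin p → ℝ) : Measure ℝ :=
  (volume.restrict (Set.Ioi (0 : ℝ))).withDensity fun t =>
    ENNReal.ofReal
      (condTauDensity a b c v t / ∫ s in Set.Ioi (0 : ℝ), condTauDensity a b c v s)

/-- The matrix `Xᵀ X + Ψ`, where `Ψ` is diagonal with entries `1 / v k`. -/
def precision {n p : ℕ} (X : Matrix (Fin n) (Fin p) ℝ) (v : Fin p → ℝ) :
    Matrix (Fin p) (Fin p) ℝ :=
  Xᵀ * X + Matrix.diagonal fun k => 1 / v k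

/-- The conditional law of `σ²` given that the vector of local scales is `v`:
`IG(n / 2 + a', (‖y‖² - yᵀ X (Xᵀ X + Ψ)⁻¹ Xᵀ y) / 2 + b')`, with `aσ`, `bσ` for `a'`, `b'`. -/
def sigmaLaw {n p : ℕ} (X : Matrix (Fin n) (Fin p) ℝ) (y : Fin n → ℝ) (aσ bσ : ℝ)
    (v : Fin p → ℝ) : Measure ℝ :=
  invGammaLaw ((n : ℝ) / 2 + aσ)
    ((y ⬝ᵥ y - (Xᵀ *ᵥ y) ⬝ᵥ ((precision X v)⁻¹ *ᵥ (Xᵀ *ᵥ y))) / 2 + bσ)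

/-- The conditional law of `β` given `σ²` and that the vector of local scales is `v`: the normal
distribution with mean `(Xᵀ X + Ψ)⁻¹ Xᵀ y` and covariance matrix `σ² (Xᵀ X + Ψ)⁻¹`. -/
def betaLaw {n p : ℕ} (X : Matrix (Fin n) (Fin p) ℝ) (y : Fin n → ℝ)
    (v : Fin p → ℝ) (σ2 : ℝ) : Measure (EuclideanSpace ℝ (Fin p)) :=
  multivariateGaussian (WithLp.toLp 2 ((precision X v)⁻¹ *ᵥ (Xᵀ *ᵥ y)))
    (σ2 • (precision X v)⁻¹)

/-- The conditional law of `ν` given `τ²` and that the vector of local scales is `v`: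
independent coordinates `ν k ∼ IG(1, 1 + τ² / v k)`. -/
def nuLaw {p : ℕ} (v : Fin p → ℝ) (τ2 : ℝ) : Measure (Fin p → ℝ) :=
  Measure.pi fun k => invGammaLaw 1 (1 + τ2 / v k)

/-- The second step of the sampler: the law of the new vector of local scales given
`(β, σ², ν, τ²)`, with independent coordinates `IG(1, β k ^ 2 / (2 σ²) + τ² / ν k)`. -/
def lambdaLaw {p : ℕ} (β : EuclideanSpace ℝ (Fin p)) (σ2 : ℝ) (ν : Fin p → ℝ) (τ2 : ℝ) :
    Measure (Fin p → ℝ) :=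
  Measure.pi fun k => invGammaLaw 1 (β k ^ 2 / (2 * σ2) + τ2 / ν k)

/-- Expectation of a nonnegative function of `(β, σ², ν, τ²)` under the first step of the sampler
started from the vector of local scales `v`: `σ²` is drawn, then `β` given `σ²`, and, independently,
`τ²`, then `ν` given `τ²`. -/
def firstStepExpectation {n p : ℕ} (X : Matrix (Fin n) (Fin p) ℝ) (y : Fin n → ℝ)
    (a b c aσ bσ : ℝ) (v : Fin p → ℝ)
    (F : EuclideanSpace ℝ (Fin p) → ℝ → (Fin p → ℝ) → ℝ → ℝ≥0∞) : ℝ≥0∞ :=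
  ∫⁻ σ2, ∫⁻ β, ∫⁻ τ2, ∫⁻ ν, F β σ2 ν τ2
    ∂(nuLaw v τ2) ∂(tauLaw a b c v) ∂(betaLaw X y v σ2) ∂(sigmaLaw X y aσ bσ v)

/-- The transition operator `P` of the chain of local scales produced by the two-stage Gibbs
sampler, `(P V)(v) = E[E[V(new scales) | β, σ², ν, τ²] | scales = v]`, with values in `[0, ∞]`,
acting on functions `V` that are nonnegative on `(0, ∞) ^ p`. -/
def transitionOp {n p : ℕ} (X : Matrix (Fin n) (Fin p) ℝ) (y : Fin n → ℝ)
    (a b c aσ bσ : ℝ) (V : (Fin p → ℝ) → ℝ) (v : Fin p → ℝ) : ℝ≥0∞ :=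
  firstStepExpectation X y a b c aσ bσ v fun β σ2 ν τ2 =>
    ∫⁻ w, ENNReal.ofReal (V w) ∂(lambdaLaw β σ2 ν τ2)

/-- The energy function `V(v) = ∑ k, 1 / v k ^ ε`. -/
def energy {p : ℕ} (ε : ℝ) (v : Fin p → ℝ) : ℝ :=
  ∑ k, 1 / v k ^ ε

/-- The geometric drift condition for an operator `P` and a function `V` on `(0, ∞) ^ p`: for some
`0 < δ < 1` and `Δ > 0`, `(P V)(v) ≤ Δ + δ * V(v)` for all `v` in `(0, ∞) ^ p`. -/
def DriftCondition {p : ℕ} (P : ((Fin p → ℝ) → ℝ) → (Fin p → ℝ) → ℝ≥0∞)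
    (V : (Fin p → ℝ) → ℝ) : Prop :=
  ∃ δ Δ : ℝ, 0 < δ ∧ δ < 1 ∧ 0 < Δ ∧
    ∀ v : Fin p → ℝ, (∀ k, 0 < v k) → P V v ≤ ENNReal.ofReal (Δ + δ * V v)

end

end HorseshoeGibbs

namespace HorseshoeGibbs

/-! ### Gamma and inverse gamma laws -/

/-! Start the chain at `v = s x` with `x` fixed and let `s → 0`. The energy is `s ^ (-ε) * ∑ x k ^
(-ε)`, so after multiplication by `s ^ ε` the constant `Δ` disappears, and drift would force the
lower limit of `s ^ ε * (P V)(s x)` to be at most `δ * ∑ x k ^ (-ε)`. It is enough to find `x` for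
which this fails.

At this scale the data disappear: `β k ^ 2 / (2 σ2)` behaves like `s * x k * z ^ 2 / 2` with `z`
standard normal, and `τ2 = s u`, where `u` has limiting density proportional to `u ^ (a + p / 2 - 1)
/ ∏ (x k + u)`. With `e` standard exponential and `w = u / (x k + u)`, the `k`-th term tends to at
least `x k ^ (-ε) * Γ(1 + ε) * E[(z ^ 2 / 2 + w e) ^ (-ε)]`. Only lower bounds matter, so Fatou's
lemma suffices (`exists_limit_le_of_driftCondition`).

Take `m` coordinates of `x` equal to `1` and the others equal to a large `K`. On the first block `w
≤ 1`, and `z ^ 2 / 2 + e` is Gamma(3/2), so the factor is at least `Γ(1 + ε) Γ(3/2 - ε) / Γ(3/2) = 1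
+ (2 log 2 - 2) ε + o(ε)`. On the second block `w` is small and the factor is nearly `Γ(1 + ε) Γ(1/2
- ε) / Γ(1/2) = 1 + 2 log 2 ε + o(ε)`. The net first-order gain is close to `2 (p log 2 - m) ε`, so
`m < p log 2` is wanted. Smallness of `w` requires `u` to stay tight as `K → ∞`, which holds when `u
^ (a + p / 2 - 1) / (1 + u) ^ m` is integrable, that is, `a + p / 2 < m`. The numerical hypothesis
says `a + p / 2 + 1 < p log 2`, so such an integer exists.

`K` is fixed before `ε`, so replacing `w` by `0` must cost only a small multiple of `ε`; this is
`rpow_neg_le_add`. `not_driftCondition` combines the estimates. -/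

theorem lintegral_Ioi_comp_mul_left (f : ℝ → ℝ≥0∞) {s : ℝ} (hs : 0 < s) :
    ∫⁻ t in Set.Ioi (0 : ℝ), f t
      = ∫⁻ u in Set.Ioi (0 : ℝ), ENNReal.ofReal s * f (s * u) := by
  have him : (fun u : ℝ => s * u) '' Set.Ioi 0 = Set.Ioi 0 := by
    rw [Set.image_mul_left_Ioi hs, mul_zero]
  have := lintegral_image_eq_lintegral_abs_deriv_mul (s := Set.Ioi (0 : ℝ))
    (f := fun u => s * u) (f' := fun _ => s) measurableSet_Ioi
    (fun x _ => by simpa using ((hasDerivAt_id x).const_mul s).hasDerivWithinAt)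
    (mul_right_injective₀ hs.ne').injOn f
  rw [him, abs_of_pos hs] at this
  exact this

theorem lintegral_gammaMeasure {α r : ℝ} (f : ℝ → ℝ≥0∞) :
    ∫⁻ x, f x ∂(gammaMeasure α r) = ∫⁻ x in Set.Ioi (0 : ℝ),
      ENNReal.ofReal (r ^ α / Real.Gamma α * x ^ (α - 1) * Real.exp (-(r * x))) * f x := by
  rw [gammaMeasure, lintegral_withDensity_eq_lintegral_mul_non_measurable]
  · rw [← setLIntegral_congr Ioi_ae_eq_Ici.symm, ← lintegral_indicator measurableSet_Ici]
    congr 1 with x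
    by_cases hx : 0 ≤ x
    · simp [Set.indicator, hx, gammaPDF_of_nonneg]
    · simp [Set.indicator, hx, gammaPDF_of_neg (not_le.1 hx)]
  · exact (measurable_gammaPDFReal α r).ennreal_ofReal
  · simp [gammaPDF]

theorem ae_pos_gammaMeasure (α r : ℝ) : ∀ᵐ x ∂(gammaMeasure α r), 0 < x := by
  have hm : Measurable (gammaPDF α r) := (measurable_gammaPDFReal α r).ennreal_ofReal
  rw [gammaMeasure, ae_withDensity_iff hm]
  have h : ∀ᵐ x : ℝ, x ≠ 0 := by simp [ae_iff]
  filter_upwards [h] with x hx0 hx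
  rcases lt_trichotomy x 0 with h | h | h
  · exact absurd (gammaPDF_of_neg h) hx
  · exact absurd h hx0
  · exact h

theorem lintegral_gammaMeasure_rate {α r : ℝ} (hr : 0 < r) (f : ℝ → ℝ≥0∞) :
    ∫⁻ x, f x ∂(gammaMeasure α r) = ∫⁻ x, f (x / r) ∂(gammaMeasure α 1) := by
  rw [lintegral_gammaMeasure, lintegral_gammaMeasure,
    lintegral_Ioi_comp_mul_left _ (inv_pos.2 hr)]
  refine setLIntegral_congr_fun measurableSet_Ioi fun x (hx : 0 < x) => ?_
  have h1 : r⁻¹ * x = x / r := by ring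
  simp only [h1]
  rw [← mul_assoc, ← ENNReal.ofReal_mul (by positivity)]
  congr 2
  rw [Real.div_rpow hx.le hr.le, Real.rpow_sub_one hr.ne', mul_div_cancel₀ _ hr.ne', Real.one_rpow,
    one_mul]
  have := (Real.rpow_pos_of_pos hr α).ne'
  field_simp

theorem lintegral_invGammaLaw {α r : ℝ} (hr : 0 < r) (f : ℝ → ℝ≥0∞) :
    ∫⁻ x, f x ∂(invGammaLaw α r) = ∫⁻ x, f (r / x) ∂(gammaMeasure α 1) := by
  have h := (MeasurableEquiv.inv ℝ).measurableEmbedding.lintegral_map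
    (μ := gammaMeasure α r) f
  have h2 : invGammaLaw α r = (gammaMeasure α r).map (MeasurableEquiv.inv ℝ) := rfl
  rw [h2, h, lintegral_gammaMeasure_rate hr]
  simp

theorem isProbabilityMeasure_invGammaLaw {α r : ℝ} (hα : 0 < α) (hr : 0 < r) :
    IsProbabilityMeasure (invGammaLaw α r) := by
  have := isProbabilityMeasure_gammaMeasure hα hr
  exact Measure.isProbabilityMeasure_map (by fun_prop)

theorem ae_pos_invGammaLaw (α r : ℝ) : ∀ᵐ x ∂(invGammaLaw α r), 0 < x := by
  rw [invGammaLaw, ae_map_iff (by fun_prop) measurableSet_Ioi]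
  filter_upwards [ae_pos_gammaMeasure α r] with x hx using inv_pos.2 hx

theorem lintegral_rpow_gammaMeasure {α κ : ℝ} (hα : 0 < α) (hκ : 0 < α + κ) :
    ∫⁻ x, ENNReal.ofReal (x ^ κ) ∂(gammaMeasure α 1)
      = ENNReal.ofReal (Real.Gamma (α + κ) / Real.Gamma α) := by
  have h1 : ∫⁻ x in Set.Ioi (0 : ℝ),
      ENNReal.ofReal (Real.exp (-x) * x ^ (α + κ - 1)) = ENNReal.ofReal (Real.Gamma (α + κ)) := by
    rw [Real.Gamma_eq_integral hκ, ofReal_integral_eq_lintegral_ofReal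
      (Real.GammaIntegral_convergent hκ)]
    exact (ae_restrict_iff' measurableSet_Ioi).2
      (ae_of_all _ fun x (hx : 0 < x) => by positivity)
  have hΓ := Real.Gamma_pos_of_pos hα
  rw [lintegral_gammaMeasure, div_eq_inv_mul (Real.Gamma (α + κ)),
    ENNReal.ofReal_mul (by positivity), ← h1, ← lintegral_const_mul' _ _ ENNReal.ofReal_ne_top]
  refine setLIntegral_congr_fun measurableSet_Ioi fun x (hx : 0 < x) => ?_
  rw [← ENNReal.ofReal_mul (inv_nonneg.2 hΓ.le), ← ENNReal.ofReal_mul (by positivity)]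
  congr 1
  rw [show α + κ - 1 = (α - 1) + κ by ring, Real.rpow_add hx]
  simp
  ring

theorem lintegral_rpow_invGammaLaw {ε r : ℝ} (hε : 0 < 1 + ε) (hr : 0 < r) :
    ∫⁻ x, ENNReal.ofReal (1 / x ^ ε) ∂(invGammaLaw 1 r)
      = ENNReal.ofReal (Real.Gamma (1 + ε)) * ENNReal.ofReal (r ^ (-ε)) := by
  rw [lintegral_invGammaLaw hr, mul_comm]
  have := lintegral_rpow_gammaMeasure (α := 1) one_pos hε
  rw [Real.Gamma_one, div_one] at this
  rw [← this, ← lintegral_const_mul' _ _ ENNReal.ofReal_ne_top]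
  refine lintegral_congr_ae ?_
  filter_upwards [ae_pos_gammaMeasure 1 1] with x hx
  rw [← ENNReal.ofReal_mul (by positivity), Real.div_rpow hr.le hx.le, Real.rpow_neg hr.le]
  congr 1
  field_simp

/-! ### The second step and the law of `ν` -/

theorem lintegral_energy_lambdaLaw {p : ℕ} {ε : ℝ} (hε : 0 < 1 + ε)
    (β : EuclideanSpace ℝ (Fin p)) (σ2 : ℝ) (ν : Fin p → ℝ) (τ2 : ℝ)
    (hr : ∀ k, 0 < β k ^ 2 / (2 * σ2) + τ2 / ν k) :
    ∫⁻ w, ENNReal.ofReal (energy ε w) ∂(lambdaLaw β σ2 ν τ2)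
      = ∑ k, ENNReal.ofReal (Real.Gamma (1 + ε)) *
          ENNReal.ofReal ((β k ^ 2 / (2 * σ2) + τ2 / ν k) ^ (-ε)) := by
  have hP : ∀ k, IsProbabilityMeasure (invGammaLaw 1 (β k ^ 2 / (2 * σ2) + τ2 / ν k)) :=
    fun k => isProbabilityMeasure_invGammaLaw one_pos (hr k)
  have hmp : ∀ k, MeasurePreserving (Function.eval k) (lambdaLaw β σ2 ν τ2)
      (invGammaLaw 1 (β k ^ 2 / (2 * σ2) + τ2 / ν k)) := fun k => measurePreserving_eval _ k
  have hpos : ∀ᵐ w ∂(lambdaLaw β σ2 ν τ2), ∀ k, 0 < w k :=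
    ae_all_iff.2 fun k => (hmp k).quasiMeasurePreserving.ae (ae_pos_invGammaLaw 1 _)
  have h1 : ∫⁻ w, ENNReal.ofReal (energy ε w) ∂(lambdaLaw β σ2 ν τ2)
      = ∫⁻ w, ∑ k, ENNReal.ofReal (1 / w k ^ ε) ∂(lambdaLaw β σ2 ν τ2) := by
    refine lintegral_congr_ae ?_
    filter_upwards [hpos] with w hw
    exact ENNReal.ofReal_sum_of_nonneg fun k _ => by have := hw k; positivity
  rw [h1, lintegral_finsetSum _ fun k _ => by fun_prop]
  refine Finset.sum_congr rfl fun k _ => ?_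
  rw [← lintegral_rpow_invGammaLaw hε (hr k)]
  exact (hmp k).lintegral_comp (f := fun x => ENNReal.ofReal (1 / x ^ ε)) (by fun_prop)

/-- `E[(B + q e) ^ (-ε)]` for a standard exponential variable `e`. -/
noncomputable def expMoment (ε B q : ℝ) : ℝ≥0∞ :=
  ∫⁻ e, ENNReal.ofReal ((B + q * e) ^ (-ε)) ∂(gammaMeasure 1 1)

/-- Writing `ν k = (1 + τ2 / v k) / e` with `e` standard exponential turns `τ2 / ν k` into `τ2 / (1
+ τ2 / v k) * e`, so `ν` is integrated out exactly. -/
theorem lintegral_nuLaw {p : ℕ} {ε τ2 : ℝ} {v : Fin p → ℝ} (hv : ∀ k, 0 < v k) (hτ : 0 < τ2)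
    (B : ℝ) (k : Fin p) :
    ∫⁻ ν, ENNReal.ofReal ((B + τ2 / ν k) ^ (-ε)) ∂(nuLaw v τ2)
      = expMoment ε B (τ2 / (1 + τ2 / v k)) := by
  have hr : ∀ k, 0 < 1 + τ2 / v k := fun k => by have := hv k; positivity
  have hP : ∀ k, IsProbabilityMeasure (invGammaLaw 1 (1 + τ2 / v k)) :=
    fun k => isProbabilityMeasure_invGammaLaw one_pos (hr k)
  have hmp : MeasurePreserving (Function.eval k) (nuLaw v τ2)
      (invGammaLaw 1 (1 + τ2 / v k)) := measurePreserving_eval _ k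
  rw [show ∫⁻ ν, ENNReal.ofReal ((B + τ2 / ν k) ^ (-ε)) ∂(nuLaw v τ2) =
    ∫⁻ x, ENNReal.ofReal ((B + τ2 / x) ^ (-ε)) ∂(invGammaLaw 1 (1 + τ2 / v k)) from
    hmp.lintegral_comp (f := fun x => ENNReal.ofReal ((B + τ2 / x) ^ (-ε))) (by fun_prop),
    lintegral_invGammaLaw (hr k), expMoment]
  congr 1 with x
  rw [div_div_eq_mul_div, mul_div_right_comm]

theorem ae_pos_nuLaw {p : ℕ} {τ2 : ℝ} {v : Fin p → ℝ} (hv : ∀ k, 0 < v k) (hτ : 0 < τ2) :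
    ∀ᵐ ν ∂(nuLaw v τ2), ∀ k, 0 < ν k := by
  have hP : ∀ k, IsProbabilityMeasure (invGammaLaw 1 (1 + τ2 / v k)) :=
    fun k => isProbabilityMeasure_invGammaLaw one_pos (by have := hv k; positivity)
  have hmp : ∀ k, MeasurePreserving (Function.eval k) (nuLaw v τ2)
      (invGammaLaw 1 (1 + τ2 / v k)) := fun k => measurePreserving_eval _ k
  exact ae_all_iff.2 fun k => (hmp k).quasiMeasurePreserving.ae (ae_pos_invGammaLaw 1 _)

theorem expMoment_anti {ε B B' q q' : ℝ} (hε : 0 ≤ ε) (hB : 0 ≤ B) (hBB : B ≤ B')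
    (hq : 0 < q) (hqq : q ≤ q') : expMoment ε B' q' ≤ expMoment ε B q := by
  refine lintegral_mono_ae ?_
  filter_upwards [ae_pos_gammaMeasure 1 1] with e he
  refine ENNReal.ofReal_le_ofReal (Real.rpow_le_rpow_of_nonpos (by positivity) ?_ (by linarith))
  gcongr

/-- This homogeneity extracts `(s * x k) ^ (-ε)`, the `k`-th term of the energy at the starting
point. -/
theorem expMoment_mul {ε B q s : ℝ} (hs : 0 < s) (hB : 0 ≤ B) (hq : 0 ≤ q) :
    expMoment ε (s * B) (s * q) = ENNReal.ofReal (s ^ (-ε)) * expMoment ε B q := by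
  rw [expMoment, expMoment, ← lintegral_const_mul' _ _ ENNReal.ofReal_ne_top]
  refine lintegral_congr_ae ?_
  filter_upwards [ae_pos_gammaMeasure 1 1] with e he
  rw [← ENNReal.ofReal_mul (by positivity), ← Real.mul_rpow hs.le (by positivity)]
  ring_nf

instance : IsProbabilityMeasure (gammaMeasure 1 1) :=
  isProbabilityMeasure_gammaMeasure one_pos one_pos

theorem measurable_expMoment (ε : ℝ) : Measurable fun z : ℝ × ℝ => expMoment ε z.1 z.2 := by
  unfold expMoment
  have : Measurable fun z : (ℝ × ℝ) × ℝ => ENNReal.ofReal ((z.1.1 + z.1.2 * z.2) ^ (-ε)) := by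
    fun_prop
  exact this.lintegral_prod_right'

@[fun_prop]
theorem measurable_expMoment_comp {Ω : Type*} [MeasurableSpace Ω] {ε : ℝ} {f g : Ω → ℝ}
    (hf : Measurable f) (hg : Measurable g) : Measurable fun ω => expMoment ε (f ω) (g ω) :=
  (measurable_expMoment ε).comp (hf.prodMk hg)

/-- Superadditivity of the lower integral needs no measurability, and a lower bound for the chain
needs no more than this inequality. -/
theorem sum_lintegral_le {ι Ω : Type*} [MeasurableSpace Ω] (μ : Measure Ω) (S : Finset ι)
    (f : ι → Ω → ℝ≥0∞) : ∑ i ∈ S, ∫⁻ x, f i x ∂μ ≤ ∫⁻ x, ∑ i ∈ S, f i x ∂μ := by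
  classical
  induction S using Finset.induction_on with
  | empty => simp
  | insert i S hi ih =>
    simp only [Finset.sum_insert hi]
    exact (add_le_add le_rfl ih).trans (le_lintegral_add _ _)

theorem ae_pos_tauLaw {p : ℕ} (a b c : ℝ) (v : Fin p → ℝ) : ∀ᵐ t ∂(tauLaw a b c v), 0 < t :=
  (withDensity_absolutelyContinuous _ _).ae_le (ae_restrict_mem measurableSet_Ioi)

/-- The factor `Γ(1 + ε)` comes from the last draw: under `IG(1, r)` the moment of order `-ε` is
`Γ(1 + ε) * r ^ (-ε)`. -/
theorem sum_le_transitionOp {n p : ℕ} (X : Matrix (Fin n) (Fin p) ℝ) (y : Fin n → ℝ)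
    (a b c aσ bσ : ℝ) {ε : ℝ} (hε : 0 < 1 + ε) {v : Fin p → ℝ} (hv : ∀ k, 0 < v k) :
    ∑ k, ENNReal.ofReal (Real.Gamma (1 + ε)) * ∫⁻ σ2, ∫⁻ β, ∫⁻ τ2,
        expMoment ε (β k ^ 2 / (2 * σ2)) (τ2 / (1 + τ2 / v k))
        ∂(tauLaw a b c v) ∂(betaLaw X y v σ2) ∂(sigmaLaw X y aσ bσ v)
      ≤ transitionOp X y a b c aσ bσ (energy ε) v := by
  unfold transitionOp firstStepExpectation
  rw [← Finset.mul_sum]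
  refine (mul_le_mul_right (sum_lintegral_le _ _ _) _).trans ?_
  rw [← lintegral_const_mul' _ _ ENNReal.ofReal_ne_top]
  refine lintegral_mono_ae ?_
  filter_upwards [ae_pos_invGammaLaw _ _] with σ2 hσ
  refine (mul_le_mul_right (sum_lintegral_le _ _ _) _).trans ?_
  rw [← lintegral_const_mul' _ _ ENNReal.ofReal_ne_top]
  refine lintegral_mono fun β => ?_
  refine (mul_le_mul_right (sum_lintegral_le _ _ _) _).trans ?_
  rw [← lintegral_const_mul' _ _ ENNReal.ofReal_ne_top]
  refine lintegral_mono_ae ?_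
  filter_upwards [ae_pos_tauLaw a b c v] with τ2 hτ
  simp_rw [← lintegral_nuLaw (ε := ε) hv hτ]
  refine (mul_le_mul_right (sum_lintegral_le _ _ _) _).trans ?_
  rw [← lintegral_const_mul' _ _ ENNReal.ofReal_ne_top]
  refine lintegral_mono_ae ?_
  filter_upwards [ae_pos_nuLaw hv hτ] with ν hν
  rw [lintegral_energy_lambdaLaw hε _ _ _ _ fun k => by have := hν k; positivity,
    Finset.mul_sum]

/-! ### The law of `τ²` -/

theorem integrableOn_rpow_div_add_rpow {α β d : ℝ} (hα : 0 < α) (hαβ : α < β) (hd : 0 < d) :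
    IntegrableOn (fun t : ℝ => t ^ (α - 1) / (d + t) ^ β) (Set.Ioi 0) := by
  have hm : Measurable fun t : ℝ => t ^ (α - 1) / (d + t) ^ β := by fun_prop
  rw [← Set.Ioc_union_Ioi_eq_Ioi zero_le_one]
  refine IntegrableOn.union ?_ ?_
  · have h : IntegrableOn (fun t : ℝ => (d ^ β)⁻¹ * t ^ (α - 1)) (Set.Ioc 0 1) := by
      refine Integrable.const_mul ?_ _
      exact ((intervalIntegrable_iff_integrableOn_Ioc_of_le zero_le_one).1
        (intervalIntegral.intervalIntegrable_rpow' (by linarith)))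
    refine Integrable.mono' h hm.aestronglyMeasurable ?_
    refine (ae_restrict_iff' measurableSet_Ioc).2 (ae_of_all _ fun t ht => ?_)
    have ht0 : 0 < t := ht.1
    rw [Real.norm_of_nonneg (by positivity), div_eq_inv_mul]
    have : d ≤ d + t := by linarith
    have : 0 ≤ β := by linarith
    gcongr
  · have h : IntegrableOn (fun t : ℝ => t ^ (α - 1 - β)) (Set.Ioi 1) :=
      integrableOn_Ioi_rpow_of_lt (by linarith) one_pos
    refine Integrable.mono' h hm.aestronglyMeasurable ?_
    refine (ae_restrict_iff' measurableSet_Ioi).2 (ae_of_all _ fun t ht => ?_)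
    have ht0 : 0 < t := one_pos.trans ht
    rw [Real.norm_of_nonneg (by positivity), Real.rpow_sub ht0 (α - 1) β]
    have : t ≤ d + t := by linarith
    have : 0 ≤ β := by linarith
    gcongr

theorem setIntegral_Ioi_pos {f : ℝ → ℝ} (hf : IntegrableOn f (Set.Ioi 0))
    (hpos : ∀ t, 0 < t → 0 < f t) : 0 < ∫ t in Set.Ioi (0 : ℝ), f t := by
  rw [setIntegral_pos_iff_support_of_nonneg_ae _ hf]
  · have : Set.Ioi (0 : ℝ) ⊆ Function.support f ∩ Set.Ioi 0 :=
      fun t ht => ⟨(hpos t ht).ne', ht⟩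
    exact lt_of_lt_of_le (by simp) (measure_mono this)
  · exact (ae_restrict_iff' measurableSet_Ioi).2 (ae_of_all _ fun t ht => (hpos t ht).le)

/-- The unnormalised conditional density of `τ² / s` when the vector of local scales is `s x`. -/
noncomputable def tauKernel {p : ℕ} (a b c : ℝ) (x : Fin p → ℝ) (s u : ℝ) : ℝ :=
  u ^ (a + p / 2 - 1) / (c + s * u) ^ (a + b) / ∏ k, (x k + u)

section tauKernel

variable {p : ℕ} {a b c : ℝ} {x : Fin p → ℝ}

theorem tauKernel_pos (hc : 0 < c) (hx : ∀ k, 1 ≤ x k) {s u : ℝ} (hs : 0 ≤ s) (hu : 0 < u) :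
    0 < tauKernel a b c x s u := by
  have : 0 < ∏ k, (x k + u) := Finset.prod_pos fun k _ => by linarith [hx k]
  unfold tauKernel
  positivity

theorem tauKernel_le (ha : 0 < a) (hb : 0 < b) (hc : 0 < c) (hx : ∀ k, 1 ≤ x k) {s u : ℝ}
    (hs : 0 ≤ s) (hu : 0 < u) : tauKernel a b c x s u ≤ tauKernel a b c x 0 u := by
  have : 0 < ∏ k, (x k + u) := Finset.prod_pos fun k _ => by linarith [hx k]
  unfold tauKernel
  gcongr

theorem measurable_tauKernel : Measurable fun z : ℝ × ℝ => tauKernel a b c x z.1 z.2 := by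
  unfold tauKernel
  have : Measurable fun z : ℝ × ℝ => ∏ k, (x k + z.2) :=
    Finset.measurable_prod _ fun k _ => by fun_prop
  fun_prop

@[fun_prop]
theorem measurable_tauKernel_comp {Ω : Type*} [MeasurableSpace Ω] {f g : Ω → ℝ}
    (hf : Measurable f) (hg : Measurable g) :
    Measurable fun ω => tauKernel a b c x (f ω) (g ω) :=
  (measurable_tauKernel (a := a) (b := b) (c := c) (x := x)).comp (hf.prodMk hg)

theorem integrableOn_tauKernel (ha : 0 < a) (hb : 0 < b) (hc : 0 < c) (hx : ∀ k, 1 ≤ x k)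
    (hap : a + p / 2 < p) {s : ℝ} (hs : 0 ≤ s) :
    IntegrableOn (tauKernel a b c x s) (Set.Ioi 0) := by
  have h := (integrableOn_rpow_div_add_rpow (α := a + p / 2) (by positivity) hap one_pos).const_mul
    (c ^ (a + b))⁻¹
  refine Integrable.mono' h
    (measurable_tauKernel.comp measurable_prodMk_left).aestronglyMeasurable ?_
  refine (ae_restrict_iff' measurableSet_Ioi).2 (ae_of_all _ fun u (hu : 0 < u) => ?_)
  rw [Real.norm_of_nonneg (tauKernel_pos hc hx hs hu).le]
  refine (tauKernel_le ha hb hc hx hs hu).trans ?_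
  have h2 : (1 + u) ^ (p : ℝ) ≤ ∏ k, (x k + u) := by
    calc (1 + u) ^ (p : ℝ) = ∏ k : Fin p, (1 + u) := by simp
      _ ≤ _ := Finset.prod_le_prod (fun k _ => by positivity) fun k _ => by linarith [hx k]
  unfold tauKernel
  rw [zero_mul, add_zero, div_right_comm, div_eq_inv_mul _ (c ^ (a + b))]
  gcongr

theorem condTauDensity_mul {s u : ℝ} (hs : 0 < s) (hu : 0 < u) :
    condTauDensity a b c (fun k => s * x k) (s * u)
      = s ^ (a - 1 - p / 2) / (∫ t in Set.Ioi (0 : ℝ), t ^ (a - 1) / (c + t) ^ (a + b))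
        * tauKernel a b c x s u := by
  unfold condTauDensity priorTau tauKernel
  have h1 : ∏ k, (s * u) ^ (1 / 2 : ℝ) / (s * x k + s * u)
      = (s * u) ^ (p / 2 : ℝ) / (s ^ (p : ℝ) * ∏ k, (x k + u)) := by
    rw [Finset.prod_div_distrib, Finset.prod_const, Finset.card_univ, Fintype.card_fin,
      ← Real.rpow_natCast ((s * u) ^ (1 / 2 : ℝ)), ← Real.rpow_mul (by positivity)]
    simp_rw [← mul_add]
    rw [Finset.prod_mul_distrib, Finset.prod_const, Finset.card_univ, Fintype.card_fin,
      Real.rpow_natCast]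
    congr 2
    ring
  have h2 : s ^ (a - 1 - p / 2) = s ^ (a - 1) * s ^ (p / 2 : ℝ) / s ^ (p : ℝ) := by
    rw [← Real.rpow_add hs, ← Real.rpow_sub hs]
    congr 1
    ring
  have h3 : u ^ (a + p / 2 - 1) = u ^ (a - 1) * u ^ (p / 2 : ℝ) := by
    rw [← Real.rpow_add hu]
    congr 1
    ring
  rw [h1, h2, h3, Real.mul_rpow hs.le hu.le, Real.mul_rpow hs.le hu.le]
  simp only [div_eq_mul_inv, mul_inv]
  ring

/-- Substitute `t = s u`: the prefactor in `condTauDensity_mul` cancels against the normalising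
constant. Replacing the mass of the kernel by its larger value at `s = 0` keeps a lower bound and
leaves `s` only in the numerator, ready for Fatou. -/
theorem le_lintegral_tauLaw (ha : 0 < a) (hb : 0 < b) (hc : 0 < c) (hx : ∀ k, 1 ≤ x k)
    (hap : a + p / 2 < p) {s : ℝ} (hs : 0 < s) (g : ℝ → ℝ≥0∞) :
    ∫⁻ u in Set.Ioi (0 : ℝ), ENNReal.ofReal
        (tauKernel a b c x s u / ∫ t in Set.Ioi (0 : ℝ), tauKernel a b c x 0 t) * g (s * u)
      ≤ ∫⁻ t, g t ∂(tauLaw a b c fun k => s * x k) := by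
  set C := ∫ t in Set.Ioi (0 : ℝ), t ^ (a - 1) / (c + t) ^ (a + b) with hC
  have hC0 : 0 < C := setIntegral_Ioi_pos
    (integrableOn_rpow_div_add_rpow ha (by linarith) hc) fun t ht => by positivity
  set κ := s ^ (a - 1 - p / 2) / C with hκ
  have hκ0 : 0 < κ := by positivity
  have hI := integrableOn_tauKernel ha hb hc hx hap hs.le
  have hI0 : 0 < ∫ t in Set.Ioi (0 : ℝ), tauKernel a b c x s t :=
    setIntegral_Ioi_pos hI fun t ht => tauKernel_pos hc hx hs.le ht
  have hle : ∫ t in Set.Ioi (0 : ℝ), tauKernel a b c x s t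
      ≤ ∫ t in Set.Ioi (0 : ℝ), tauKernel a b c x 0 t :=
    setIntegral_mono_on hI (integrableOn_tauKernel ha hb hc hx hap le_rfl) measurableSet_Ioi
      fun t ht => tauKernel_le ha hb hc hx hs.le ht
  have hnorm : ∫ t in Set.Ioi (0 : ℝ), condTauDensity a b c (fun k => s * x k) t
      = s * (κ * ∫ t in Set.Ioi (0 : ℝ), tauKernel a b c x s t) := by
    rw [← integral_const_mul κ, ← setIntegral_congr_fun measurableSet_Ioi
      fun u hu => condTauDensity_mul (a := a) (b := b) (c := c) (x := x) hs hu,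
      integral_comp_mul_left_Ioi _ _ hs, mul_zero, smul_eq_mul, mul_inv_cancel_left₀ hs.ne']
  rw [tauLaw, lintegral_withDensity_eq_lintegral_mul_non_measurable]
  · simp only [Pi.mul_apply]
    rw [lintegral_Ioi_comp_mul_left (fun t => ENNReal.ofReal _ * g t) hs]
    refine setLIntegral_mono' measurableSet_Ioi fun u (hu : 0 < u) => ?_
    rw [← mul_assoc, ← ENNReal.ofReal_mul hs.le, hnorm, condTauDensity_mul hs hu]
    gcongr
    rw [show s * (κ * tauKernel a b c x s u /
        (s * (κ * ∫ t in Set.Ioi (0 : ℝ), tauKernel a b c x s t)))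
        = tauKernel a b c x s u / ∫ t in Set.Ioi (0 : ℝ), tauKernel a b c x s t by field_simp]
    have := (tauKernel_pos (a := a) (b := b) hc hx hs.le hu).le
    gcongr
  · have : Measurable fun t => condTauDensity a b c (fun k => s * x k) t := by
      unfold condTauDensity priorTau
      have : Measurable fun t : ℝ => ∏ k, t ^ (1 / 2 : ℝ) / (s * x k + t) :=
        Finset.measurable_prod _ fun k _ => by fun_prop
      fun_prop
    fun_prop
  · simp

end tauKernel

/-! ### The regression coefficients and the error variance -/

section precision

variable {n p : ℕ} (X : Matrix (Fin n) (Fin p) ℝ) {v : Fin p → ℝ}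

theorem precision_posDef (hv : ∀ k, 0 < v k) : (precision X v).PosDef := by
  unfold precision
  have h1 : (Xᵀ * X).PosSemidef := by
    simpa [Matrix.conjTranspose_eq_transpose_of_trivial] using
      Matrix.posSemidef_conjTranspose_mul_self X
  exact Matrix.PosDef.posSemidef_add h1
    (Matrix.PosDef.diagonal fun k => by have := hv k; positivity)

theorem dotProduct_precision_mulVec (z : Fin p → ℝ) :
    z ⬝ᵥ (precision X v *ᵥ z) = (X *ᵥ z) ⬝ᵥ (X *ᵥ z) + ∑ k, z k ^ 2 / v k := by
  rw [precision, Matrix.add_mulVec, dotProduct_add, ← Matrix.mulVec_mulVec,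
    Matrix.dotProduct_mulVec, Matrix.vecMul_transpose]
  congr 1
  simp only [dotProduct, Matrix.mulVec_diagonal]
  refine Finset.sum_congr rfl fun k _ => by ring

theorem precision_mulVec_inv (hv : ∀ k, 0 < v k) (q : Fin p → ℝ) :
    precision X v *ᵥ ((precision X v)⁻¹ *ᵥ q) = q := by
  have hu : IsUnit (precision X v).det := (precision_posDef X hv).det_pos.ne'.isUnit
  rw [Matrix.mulVec_mulVec, Matrix.mul_nonsing_inv _ hu, Matrix.one_mulVec]

theorem inv_precision_dotProduct (hv : ∀ k, 0 < v k) (q : Fin p → ℝ) :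
    ((precision X v)⁻¹ *ᵥ q) ⬝ᵥ q
      = (X *ᵥ ((precision X v)⁻¹ *ᵥ q)) ⬝ᵥ (X *ᵥ ((precision X v)⁻¹ *ᵥ q))
        + ∑ k, ((precision X v)⁻¹ *ᵥ q) k ^ 2 / v k := by
  rw [← dotProduct_precision_mulVec, precision_mulVec_inv X hv q]

theorem sum_sq_div_le (hv : ∀ k, 0 < v k) (q : Fin p → ℝ) :
    ∑ k, ((precision X v)⁻¹ *ᵥ q) k ^ 2 / v k ≤ ((precision X v)⁻¹ *ᵥ q) ⬝ᵥ q := by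
  rw [inv_precision_dotProduct X hv]
  have : 0 ≤ (X *ᵥ ((precision X v)⁻¹ *ᵥ q)) ⬝ᵥ (X *ᵥ ((precision X v)⁻¹ *ᵥ q)) :=
    Finset.sum_nonneg fun i _ => mul_self_nonneg _
  linarith

theorem inv_precision_diag_pos (hv : ∀ k, 0 < v k) (k : Fin p) :
    0 < (precision X v)⁻¹ k k := (precision_posDef X hv).inv.diag_pos

theorem inv_precision_diag_le (hv : ∀ k, 0 < v k) (k : Fin p) :
    (precision X v)⁻¹ k k ≤ v k := by
  have h := sum_sq_div_le X hv (Pi.single k 1)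
  rw [Matrix.mulVec_single_one, dotProduct_single_one] at h
  have h1 : (precision X v)⁻¹ k k ^ 2 / v k ≤ (precision X v)⁻¹ k k :=
    (Finset.single_le_sum (f := fun j => (precision X v)⁻¹ᵀ k j ^ 2 / v j)
      (fun j _ => by have := hv j; positivity) (Finset.mem_univ k)).trans h
  have h0 := inv_precision_diag_pos X hv k
  rw [div_le_iff₀ (hv k), sq] at h1
  exact le_of_mul_le_mul_left h1 h0

/-- From `z ⬝ᵥ z ≤ M * ∑ z j ^ 2 / v j ≤ M * (z ⬝ᵥ q)`, Cauchy–Schwarz bounds the norm of `z` by `M`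
times that of `q`. For scales of order `s` the conditional mean of `β` is thus `O(s)`, which the
noise bound of order `√s` will dominate. -/
theorem abs_inv_precision_mulVec_le (hv : ∀ k, 0 < v k) {M : ℝ} (hM : ∀ k, v k ≤ M)
    (q : Fin p → ℝ) (k : Fin p) :
    |((precision X v)⁻¹ *ᵥ q) k| ≤ M * √(q ⬝ᵥ q) := by
  set z := (precision X v)⁻¹ *ᵥ q with hz
  have hM0 : 0 < M := (hv k).trans_le (hM k)
  have hzz : z ⬝ᵥ z = ∑ j, z j ^ 2 := Finset.sum_congr rfl fun j _ => (sq _).symm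
  have hqq : q ⬝ᵥ q = ∑ j, q j ^ 2 := Finset.sum_congr rfl fun j _ => (sq _).symm
  have hq0 : 0 ≤ q ⬝ᵥ q := hqq ▸ Finset.sum_nonneg fun j _ => sq_nonneg _
  have h1 : z ⬝ᵥ z ≤ M * (z ⬝ᵥ q) := by
    calc z ⬝ᵥ z ≤ M * ∑ j, z j ^ 2 / v j := by
          rw [hzz, Finset.mul_sum]
          refine Finset.sum_le_sum fun j _ => ?_
          rw [mul_div_assoc', le_div_iff₀ (hv j), mul_comm]
          exact mul_le_mul_of_nonneg_right (hM j) (sq_nonneg _)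
      _ ≤ _ := mul_le_mul_of_nonneg_left (sum_sq_div_le X hv q) hM0.le
  have h2 : (z ⬝ᵥ q) ^ 2 ≤ (z ⬝ᵥ z) * (q ⬝ᵥ q) := by
    rw [hzz, hqq]
    exact Finset.sum_mul_sq_le_sq_mul_sq _ _ _
  have h3 : z k ^ 2 ≤ z ⬝ᵥ z :=
    hzz ▸ Finset.single_le_sum (fun j _ => sq_nonneg (z j)) (Finset.mem_univ k)
  have h4 : z ⬝ᵥ z ≤ M ^ 2 * (q ⬝ᵥ q) := by
    rcases (hzz ▸ Finset.sum_nonneg fun j _ => sq_nonneg (z j) : 0 ≤ z ⬝ᵥ z).eq_or_lt with h | h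
    · rw [← h]; positivity
    · refine le_of_mul_le_mul_left ?_ h
      calc (z ⬝ᵥ z) * (z ⬝ᵥ z) ≤ (M * (z ⬝ᵥ q)) * (M * (z ⬝ᵥ q)) :=
            mul_le_mul h1 h1 h.le (h.le.trans h1)
        _ = M ^ 2 * (z ⬝ᵥ q) ^ 2 := by ring
        _ ≤ M ^ 2 * ((z ⬝ᵥ z) * (q ⬝ᵥ q)) := by gcongr
        _ = _ := by ring
  rw [← Real.sqrt_sq hM0.le, ← Real.sqrt_mul (sq_nonneg _)]
  exact Real.abs_le_sqrt (h3.trans h4)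

/-- Combine `0 ≤ ‖y - X z‖²` with `z ⬝ᵥ Xᵀ y = ‖X z‖² + ∑ z k ^ 2 / v k`. The rate of `σ2` is then
at least `bσ`, uniformly in `v`. -/
theorem residual_nonneg (y : Fin n → ℝ) (hv : ∀ k, 0 < v k) :
    0 ≤ y ⬝ᵥ y - (Xᵀ *ᵥ y) ⬝ᵥ ((precision X v)⁻¹ *ᵥ (Xᵀ *ᵥ y)) := by
  have h := inv_precision_dotProduct X hv (Xᵀ *ᵥ y)
  set z := (precision X v)⁻¹ *ᵥ (Xᵀ *ᵥ y)
  have h1 : z ⬝ᵥ (Xᵀ *ᵥ y) = (X *ᵥ z) ⬝ᵥ y := by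
    rw [Matrix.dotProduct_mulVec, Matrix.vecMul_transpose]
  have h2 : 0 ≤ ∑ k, z k ^ 2 / v k := Finset.sum_nonneg fun k _ => by have := hv k; positivity
  have h3 : 0 ≤ (y - X *ᵥ z) ⬝ᵥ (y - X *ᵥ z) := Finset.sum_nonneg fun i _ => mul_self_nonneg _
  rw [sub_dotProduct, dotProduct_sub, dotProduct_sub, dotProduct_comm y (X *ᵥ z)] at h3
  rw [dotProduct_comm (Xᵀ *ᵥ y) z, h1]
  linarith

theorem lintegral_betaLaw (y : Fin n → ℝ) (hv : ∀ k, 0 < v k) {σ2 : ℝ} (hσ : 0 < σ2) (k : Fin p)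
    {f : ℝ → ℝ≥0∞} (hf : Measurable f) :
    ∫⁻ β, f (β k) ∂(betaLaw X y v σ2)
      = ∫⁻ z, f (((precision X v)⁻¹ *ᵥ (Xᵀ *ᵥ y)) k + √(σ2 * (precision X v)⁻¹ k k) * z)
          ∂(gaussianReal 0 1) := by
  have hS : (σ2 • (precision X v)⁻¹).PosSemidef :=
    (precision_posDef X hv).inv.posSemidef.smul hσ.le
  have hd := inv_precision_diag_pos X hv k
  have h := (measurePreserving_eval_multivariateGaussian
    (μ := WithLp.toLp 2 ((precision X v)⁻¹ *ᵥ (Xᵀ *ᵥ y))) hS (i := k)).lintegral_comp hf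
  rw [betaLaw, h]
  set m := ((precision X v)⁻¹ *ᵥ (Xᵀ *ᵥ y)) k
  have hg : gaussianReal m (σ2 * (precision X v)⁻¹ k k).toNNReal
      = (gaussianReal 0 1).map fun z => m + √(σ2 * (precision X v)⁻¹ k k) * z := by
    have : (fun z => m + √(σ2 * (precision X v)⁻¹ k k) * z)
        = (fun z => m + z) ∘ fun z => √(σ2 * (precision X v)⁻¹ k k) * z := rfl
    rw [this, ← Measure.map_map (by fun_prop) (by fun_prop), gaussianReal_map_const_mul,
      gaussianReal_map_const_add]
    congr 1
    · simp
    · ext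
      simp [Real.sq_sqrt (mul_pos hσ hd).le, (mul_pos hσ hd).le]
  simp only [Matrix.smul_apply, smul_eq_mul]
  rw [hg, lintegral_map hf (by fun_prop)]

end precision

/-! ### Lower bound for one step of the chain -/

/-- `E[(B + w e) ^ (-ε)]`, where `w = u / (x k + u)`, `u` has the (sub)density obtained by
normalising `tauKernel a b c x s` by the mass of its limit at `s = 0`, and `e` is an independent
standard exponential variable. -/
noncomputable def tauMoment {p : ℕ} (a b c : ℝ) (x : Fin p → ℝ) (k : Fin p) (ε s B : ℝ) : ℝ≥0∞ :=
  ∫⁻ u in Set.Ioi (0 : ℝ), ENNReal.ofReal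
      (tauKernel a b c x s u / ∫ t in Set.Ioi (0 : ℝ), tauKernel a b c x 0 t)
    * expMoment ε B (u / (x k + u))

section

variable {p : ℕ} {a b c : ℝ} {x : Fin p → ℝ}

theorem le_lintegral_expMoment_tauLaw (ha : 0 < a) (hb : 0 < b) (hc : 0 < c)
    (hx : ∀ k, 1 ≤ x k) (hap : a + p / 2 < p) {s : ℝ} (hs : 0 < s) (k : Fin p) (ε B : ℝ) :
    ∫⁻ u in Set.Ioi (0 : ℝ), ENNReal.ofReal
        (tauKernel a b c x s u / ∫ t in Set.Ioi (0 : ℝ), tauKernel a b c x 0 t)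
        * expMoment ε B (s * x k * (u / (x k + u)))
      ≤ ∫⁻ τ2, expMoment ε B (τ2 / (1 + τ2 / (s * x k))) ∂(tauLaw a b c fun k => s * x k) := by
  refine le_trans (le_of_eq ?_) (le_lintegral_tauLaw ha hb hc hx hap hs _)
  refine setLIntegral_congr_fun measurableSet_Ioi fun u (hu : 0 < u) => ?_
  have hxk : 0 < x k := one_pos.trans_le (hx k)
  congr 2
  field_simp

theorem mul_tauMoment_le {ε s B B' : ℝ} (hε : 0 ≤ ε) (hx : ∀ k, 1 ≤ x k) (hs : 0 < s)
    (k : Fin p) (hB : 0 ≤ B) (hBB : B ≤ s * x k * B') :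
    ENNReal.ofReal ((s * x k) ^ (-ε)) * tauMoment a b c x k ε s B'
      ≤ ∫⁻ u in Set.Ioi (0 : ℝ), ENNReal.ofReal
        (tauKernel a b c x s u / ∫ t in Set.Ioi (0 : ℝ), tauKernel a b c x 0 t)
        * expMoment ε B (s * x k * (u / (x k + u))) := by
  have hxk : 0 < x k := one_pos.trans_le (hx k)
  have hsx : 0 < s * x k := mul_pos hs hxk
  rw [tauMoment, ← lintegral_const_mul' _ _ ENNReal.ofReal_ne_top]
  refine setLIntegral_mono' measurableSet_Ioi fun u (hu : 0 < u) => ?_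
  rw [mul_left_comm]
  gcongr
  have hB' : 0 ≤ B' := nonneg_of_mul_nonneg_right (hB.trans hBB) hsx
  rw [← expMoment_mul hsx hB' (by positivity)]
  exact expMoment_anti hε hB hBB (by positivity) le_rfl

/-- Here `σ2 = r / g`, the mean `μ` is `O(s)` and the variance factor `S` is at most `s * xk`. After
division by `s * xk` the mean contributes only a term of order `√s`. -/
theorem sq_div_le {C s r g bσ xk S μ z : ℝ} (hs : 0 < s) (hg : 0 < g) (hb : 0 < bσ) (hr : bσ ≤ r)
    (hxk : 1 ≤ xk) (hS : S ≤ s * xk) (hC : 0 ≤ C) (hμ : |μ| ≤ s * C) :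
    (μ + √(r / g * S) * z) ^ 2 / (2 * (r / g))
      ≤ s * xk * ((C * √s * √(g / bσ) + |z|) ^ 2 / 2) := by
  have hr0 : 0 < r := hb.trans_le hr
  -- The mean carries no factor `√σ2`; this inequality supplies one, so that `σ2` cancels in the
  -- quotient.
  have h1 : 1 ≤ √(r / g) * √(g / bσ) := by
    rw [← Real.sqrt_mul (by positivity), Real.one_le_sqrt,
      show r / g * (g / bσ) = r / bσ by field_simp]
    exact (one_le_div hb).2 hr
  have h2 : √s ≤ √(s * xk) := Real.sqrt_le_sqrt (by nlinarith)
  have h3 : |μ + √(r / g * S) * z|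
      ≤ √(r / g) * √(s * xk) * (C * √s * √(g / bσ) + |z|) := by
    calc |μ + √(r / g * S) * z| ≤ |μ| + |√(r / g * S) * z| := abs_add_le _ _
      _ ≤ s * C + √(r / g * (s * xk)) * |z| := by
        rw [abs_mul, abs_of_nonneg (Real.sqrt_nonneg _)]
        gcongr
      _ = (√s * √s * C) * 1 + √(r / g) * √(s * xk) * |z| := by
        rw [Real.mul_self_sqrt hs.le, Real.sqrt_mul (by positivity)]
        ring
      _ ≤ (√(s * xk) * √s * C) * (√(r / g) * √(g / bσ)) + √(r / g) * √(s * xk) * |z| := by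
        gcongr
      _ = _ := by ring
  have h4 : (μ + √(r / g * S) * z) ^ 2
      ≤ (r / g) * (s * xk) * (C * √s * √(g / bσ) + |z|) ^ 2 := by
    rw [← sq_abs]
    refine (pow_le_pow_left₀ (abs_nonneg _) h3 2).trans (le_of_eq ?_)
    rw [mul_pow, mul_pow, Real.sq_sqrt (by positivity), Real.sq_sqrt (by positivity)]
  rw [div_le_iff₀ (by positivity)]
  refine h4.trans (le_of_eq ?_)
  ring

theorem measurable_lintegral_tauKernel_mul_expMoment (k : Fin p) (ε s d Z : ℝ) :
    Measurable fun B : ℝ => ∫⁻ u in Set.Ioi (0 : ℝ), ENNReal.ofReal (tauKernel a b c x s u / Z)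
        * expMoment ε B (d * (u / (x k + u))) := by
  have h : Measurable fun z : ℝ × ℝ => ENNReal.ofReal (tauKernel a b c x s z.2 / Z)
      * expMoment ε z.1 (d * (z.2 / (x k + z.2))) := by fun_prop
  exact h.lintegral_prod_right'

/-- Lower bound for one term of the transition operator from the scales `s x`, in which the only
dependence on `s` that is left vanishes in the limit `s → 0`. -/
theorem le_firstStep {n : ℕ} (X : Matrix (Fin n) (Fin p) ℝ) (y : Fin n → ℝ) {aσ bσ ε s K : ℝ}
    (ha : 0 < a) (hb : 0 < b) (hc : 0 < c) (hbσ : 0 < bσ) (hε : 0 ≤ ε)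
    (hx : ∀ k, 1 ≤ x k) (hxK : ∀ k, x k ≤ K) (hap : a + p / 2 < p) (hs : 0 < s) (k : Fin p) :
    ENNReal.ofReal ((s * x k) ^ (-ε)) * ∫⁻ g, ∫⁻ z, tauMoment a b c x k ε s
        ((K * √((Xᵀ *ᵥ y) ⬝ᵥ (Xᵀ *ᵥ y)) * √s * √(g / bσ) + |z|) ^ 2 / 2)
        ∂(gaussianReal 0 1) ∂(gammaMeasure (n / 2 + aσ) 1)
      ≤ ∫⁻ σ2, ∫⁻ β, ∫⁻ τ2, expMoment ε (β k ^ 2 / (2 * σ2)) (τ2 / (1 + τ2 / (s * x k)))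
        ∂(tauLaw a b c fun k => s * x k) ∂(betaLaw X y (fun k => s * x k) σ2)
        ∂(sigmaLaw X y aσ bσ fun k => s * x k) := by
  have hv : ∀ k, 0 < s * x k := fun k => mul_pos hs (one_pos.trans_le (hx k))
  have hK : 0 ≤ K := (zero_le_one.trans (hx k)).trans (hxK k)
  set r := (y ⬝ᵥ y - (Xᵀ *ᵥ y) ⬝ᵥ ((precision X fun k => s * x k)⁻¹ *ᵥ (Xᵀ *ᵥ y))) / 2 + bσ with hr
  have hrb : bσ ≤ r := by
    have := residual_nonneg X y hv
    rw [hr]; linarith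
  rw [sigmaLaw, lintegral_invGammaLaw (hbσ.trans_le hrb),
    ← lintegral_const_mul' _ _ ENNReal.ofReal_ne_top]
  refine lintegral_mono_ae ?_
  filter_upwards [ae_pos_gammaMeasure _ _] with g hg
  have hσ : 0 < r / g := div_pos (hbσ.trans_le hrb) hg
  set H : ℝ → ℝ≥0∞ := fun B => ∫⁻ u in Set.Ioi (0 : ℝ), ENNReal.ofReal
        (tauKernel a b c x s u / ∫ t in Set.Ioi (0 : ℝ), tauKernel a b c x 0 t)
        * expMoment ε B (s * x k * (u / (x k + u))) with hH
  have hHm : Measurable H := measurable_lintegral_tauKernel_mul_expMoment k ε s _ _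
  calc _ ≤ ∫⁻ β, H (β k ^ 2 / (2 * (r / g))) ∂(betaLaw X y (fun k => s * x k) (r / g)) := by
        rw [lintegral_betaLaw X y hv hσ k
          (f := fun t => H (t ^ 2 / (2 * (r / g)))) (hHm.comp (by fun_prop)),
          ← lintegral_const_mul' _ _ ENNReal.ofReal_ne_top]
        refine lintegral_mono fun z => mul_tauMoment_le hε hx hs k (by positivity) ?_
        refine sq_div_le hs hg hbσ hrb (hx k) (inv_precision_diag_le X hv k) (by positivity) ?_
        rw [← mul_assoc]
        exact abs_inv_precision_mulVec_le X hv
          (fun j => mul_le_mul_of_nonneg_left (hxK j) hs.le) _ k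
    _ ≤ _ := lintegral_mono fun β => le_lintegral_expMoment_tauLaw ha hb hc hx hap hs k ε _

end

/-! ### The limit of vanishing scales -/

section limit

open Filter Topology

/-- Fatou's lemma in the form iterated over `e`, `u`, `z`, `g` and finally the index `k`. -/
theorem lintegral_le_liminf {Ω : Type*} [MeasurableSpace Ω] {μ : Measure Ω} {A : ℕ → Ω → ℝ≥0∞}
    {A₀ : Ω → ℝ≥0∞} (hA : ∀ j, Measurable (A j))
    (h : ∀ᵐ ω ∂μ, A₀ ω ≤ liminf (fun j => A j ω) atTop) :
    ∫⁻ ω, A₀ ω ∂μ ≤ liminf (fun j => ∫⁻ ω, A j ω ∂μ) atTop :=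
  (lintegral_mono_ae h).trans (lintegral_liminf_le hA)

theorem mul_expMoment_le_liminf {ε w B₀ ρ₀ : ℝ} {B ρ : ℕ → ℝ} (hw : 0 < w) (hB₀ : 0 ≤ B₀)
    (hB : Tendsto B atTop (𝓝 B₀)) (hρ : Tendsto ρ atTop (𝓝 ρ₀)) :
    ENNReal.ofReal ρ₀ * expMoment ε B₀ w
      ≤ liminf (fun j => ENNReal.ofReal (ρ j) * expMoment ε (B j) w) atTop := by
  simp_rw [expMoment, ← lintegral_const_mul' _ _ ENNReal.ofReal_ne_top]
  refine lintegral_le_liminf (fun j => by fun_prop) ?_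
  filter_upwards [ae_pos_gammaMeasure 1 1] with e he
  have h1 : Tendsto (fun j => (B j + w * e) ^ (-ε)) atTop (𝓝 ((B₀ + w * e) ^ (-ε))) :=
    (hB.add_const _).rpow_const (Or.inl (by positivity))
  exact (ENNReal.Tendsto.mul (ENNReal.tendsto_ofReal hρ) (Or.inr ENNReal.ofReal_ne_top)
    (ENNReal.tendsto_ofReal h1) (Or.inr ENNReal.ofReal_ne_top)).liminf_eq.ge

variable {p : ℕ} {a b c : ℝ} {x : Fin p → ℝ}

theorem measurable_tauMoment (k : Fin p) (ε s : ℝ) :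
    Measurable fun B : ℝ => tauMoment a b c x k ε s B := by
  have h := measurable_lintegral_tauKernel_mul_expMoment (a := a) (b := b) (c := c) (x := x) k ε s 1
    (∫ t in Set.Ioi (0 : ℝ), tauKernel a b c x 0 t)
  simp only [one_mul] at h
  exact h

@[fun_prop]
theorem measurable_tauMoment_comp {Ω : Type*} [MeasurableSpace Ω] {f : Ω → ℝ} (hf : Measurable f)
    (k : Fin p) (ε s : ℝ) : Measurable fun ω => tauMoment a b c x k ε s (f ω) :=
  (measurable_tauMoment (a := a) (b := b) (c := c) (x := x) k ε s).comp hf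

theorem tauMoment_le_liminf (hc : 0 < c) (hx : ∀ k, 1 ≤ x k) (k : Fin p) {ε B₀ : ℝ}
    {s B : ℕ → ℝ} (hB₀ : 0 ≤ B₀) (hB : Tendsto B atTop (𝓝 B₀)) (hs : Tendsto s atTop (𝓝 0)) :
    tauMoment a b c x k ε 0 B₀ ≤ liminf (fun j => tauMoment a b c x k ε (s j) (B j)) atTop := by
  unfold tauMoment
  refine lintegral_le_liminf (fun j => by fun_prop) ?_
  refine (ae_restrict_iff' measurableSet_Ioi).2 (ae_of_all _ fun u (hu : 0 < u) => ?_)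
  have hxk : 0 < x k := one_pos.trans_le (hx k)
  refine mul_expMoment_le_liminf (by positivity) hB₀ hB ?_
  refine Tendsto.div_const ?_ _
  have hprod : ∏ k, (x k + u) ≠ 0 :=
    (Finset.prod_pos fun k _ => by linarith [hx k]).ne'
  unfold tauKernel
  refine Tendsto.div_const (tendsto_const_nhds.div ?_ ?_) _
  · refine (tendsto_const_nhds.add ?_).rpow_const (Or.inl (by simpa using hc.ne'))
    exact hs.mul_const u
  · simpa using (Real.rpow_pos_of_pos hc _).ne'

theorem gaussian_tauMoment_le_liminf (hc : 0 < c) (hx : ∀ k, 1 ≤ x k) (k : Fin p)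
    {ε C bσ α : ℝ} (hα : 0 < α) {s : ℕ → ℝ} (hs : Tendsto s atTop (𝓝 0)) :
    ∫⁻ z, tauMoment a b c x k ε 0 (z ^ 2 / 2) ∂(gaussianReal 0 1)
      ≤ liminf (fun j => ∫⁻ g, ∫⁻ z, tauMoment a b c x k ε (s j)
          ((C * √(s j) * √(g / bσ) + |z|) ^ 2 / 2) ∂(gaussianReal 0 1) ∂(gammaMeasure α 1))
          atTop := by
  have := isProbabilityMeasure_gammaMeasure hα one_pos
  calc ∫⁻ z, tauMoment a b c x k ε 0 (z ^ 2 / 2) ∂(gaussianReal 0 1)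
      = ∫⁻ g, ∫⁻ z, tauMoment a b c x k ε 0 (z ^ 2 / 2) ∂(gaussianReal 0 1)
          ∂(gammaMeasure α 1) := by rw [lintegral_const, measure_univ, mul_one]
    _ ≤ _ := ?_
  refine lintegral_le_liminf (fun j => ?_) (ae_of_all _ fun g => ?_)
  · have h : Measurable fun q : ℝ × ℝ => tauMoment a b c x k ε (s j)
        ((C * √(s j) * √(q.1 / bσ) + |q.2|) ^ 2 / 2) := by fun_prop
    exact h.lintegral_prod_right'
  · refine lintegral_le_liminf (fun j => by fun_prop) (ae_of_all _ fun z => ?_)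
    refine tauMoment_le_liminf hc hx k (by positivity) ?_ hs
    rw [← sq_abs z]
    have h1 : Tendsto (fun j => C * √(s j) * √(g / bσ) + |z|) atTop
        (𝓝 (C * √0 * √(g / bσ) + |z|)) :=
      (((Real.continuous_sqrt.tendsto 0).comp hs).const_mul C |>.mul_const _).add_const _
    simp only [Real.sqrt_zero, mul_zero, zero_mul, zero_add] at h1
    exact (h1.pow 2).div_const 2

end limit

/-! ### Moments -/

/-- Half the square of a standard normal is Gamma(1/2): change variables on the positive half-line
and double by symmetry. -/
theorem lintegral_gaussianReal_half_sq (f : ℝ → ℝ≥0∞) :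
    ∫⁻ z, f (z ^ 2 / 2) ∂(gaussianReal 0 1) = ∫⁻ t, f t ∂(gammaMeasure (1 / 2) 1) := by
  have him : (fun z : ℝ => z ^ 2 / 2) '' Set.Ioi 0 = Set.Ioi 0 := by
    ext t
    refine ⟨?_, fun (ht : 0 < t) => ⟨√(2 * t), Real.sqrt_pos.2 (by positivity), ?_⟩⟩
    · rintro ⟨z, hz : 0 < z, rfl⟩
      exact (by positivity : 0 < z ^ 2 / 2)
    · simp only
      rw [Real.sq_sqrt (by positivity)]
      ring
  have hinj : Set.InjOn (fun z : ℝ => z ^ 2 / 2) (Set.Ioi 0) := by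
    intro z (hz : 0 < z) w (hw : 0 < w) h
    have : z ^ 2 = w ^ 2 := by simpa using h
    exact (sq_eq_sq₀ hz.le hw.le).1 this
  have hR := lintegral_image_eq_lintegral_abs_deriv_mul (s := Set.Ioi (0 : ℝ))
    (f := fun z => z ^ 2 / 2) (f' := fun z => z) measurableSet_Ioi
    (fun z _ => by
      have := ((hasDerivAt_pow 2 z).div_const 2).hasDerivWithinAt (s := Set.Ioi 0)
      simpa using this) hinj
    (fun x => ENNReal.ofReal (1 ^ (1 / 2 : ℝ) / Real.Gamma (1 / 2) * x ^ ((1 / 2 : ℝ) - 1) *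
      Real.exp (-(1 * x))) * f x)
  rw [him] at hR
  rw [lintegral_gammaMeasure, hR, gaussianReal_of_var_ne_zero _ one_ne_zero,
    lintegral_withDensity_eq_lintegral_mul_non_measurable _ (measurable_gaussianPDF _ _)
      (ae_of_all _ fun _ => gaussianPDF_lt_top)]
  simp only [Pi.mul_apply]
  have hneg : ∫⁻ z in Set.Iic (0 : ℝ), gaussianPDF 0 1 z * f (z ^ 2 / 2)
      = ∫⁻ z in Set.Ioi (0 : ℝ), gaussianPDF 0 1 z * f (z ^ 2 / 2) := by
    rw [setLIntegral_congr Iio_ae_eq_Iic.symm]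
    have h := (Measure.measurePreserving_neg (volume : Measure ℝ)).setLIntegral_comp_preimage_emb
      (MeasurableEquiv.neg ℝ).measurableEmbedding
      (fun z => gaussianPDF 0 1 z * f (z ^ 2 / 2)) (Set.Ioi 0)
    rw [← h]
    simp [gaussianPDF, gaussianPDFReal]
  rw [← lintegral_add_compl _ (measurableSet_Iic (a := (0 : ℝ))), Set.compl_Iic, hneg, ← two_mul,
    ← lintegral_const_mul' _ _ (by simp)]
  refine setLIntegral_congr_fun measurableSet_Ioi fun z (hz : 0 < z) => ?_
  rw [← mul_assoc, ← mul_assoc, abs_of_pos hz, ← ENNReal.ofReal_mul hz.le, gaussianPDF,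
    show (2 : ℝ≥0∞) = ENNReal.ofReal 2 by simp, ← ENNReal.ofReal_mul zero_le_two]
  congr 2
  have h1 : (z ^ 2 / 2) ^ ((1 / 2 : ℝ) - 1) = √2 / z := by
    rw [show (1 / 2 : ℝ) - 1 = -(1 / 2) by norm_num, Real.rpow_neg (by positivity),
      ← Real.sqrt_eq_rpow, Real.sqrt_div (by positivity), Real.sqrt_sq hz.le, inv_div]
  have h2 : √2 * √2 = (2 : ℝ) := Real.mul_self_sqrt zero_le_two
  rw [h1, Real.Gamma_one_half_eq, gaussianPDFReal, Real.one_rpow]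
  simp only [NNReal.coe_one, mul_one, sub_zero, one_mul]
  rw [Real.sqrt_mul zero_le_two, neg_div]
  have := Real.sqrt_pos.2 Real.pi_pos
  field_simp
  nlinarith

theorem Gamma_three_half : Real.Gamma (3 / 2) = √Real.pi / 2 := by
  rw [show (3 / 2 : ℝ) = 1 / 2 + 1 by norm_num, Real.Gamma_add_one (by norm_num),
    Real.Gamma_one_half_eq]
  ring

/-- Additivity of independent gamma variables, 1/2 + 1 = 3/2: set `r = t + e`, use Tonelli on `0 < t
< r`, and integrate `t ^ (-1/2)` over `(0, r)`. -/
theorem lintegral_gammaMeasure_one_add {h : ℝ → ℝ≥0∞} (hh : Measurable h) :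
    ∫⁻ t, ∫⁻ e, h (t + e) ∂(gammaMeasure 1 1) ∂(gammaMeasure (1 / 2) 1)
      = ∫⁻ t, h t ∂(gammaMeasure (3 / 2) 1) := by
  have hin : ∀ t : ℝ, 0 < t → ∫⁻ e, h (t + e) ∂(gammaMeasure 1 1)
      = ∫⁻ r in Set.Ioi t, ENNReal.ofReal (Real.exp (t - r)) * h r := by
    intro t ht
    rw [lintegral_gammaMeasure]
    have h1 := (measurePreserving_add_left (volume : Measure ℝ) t).setLIntegral_comp_preimage_emb
      (MeasurableEquiv.addLeft t).measurableEmbedding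
      (fun r => ENNReal.ofReal (Real.exp (t - r)) * h r) (Set.Ioi t)
    rw [← h1]
    simp
  have hinner : ∀ r : ℝ, 0 < r →
      ∫⁻ t in Set.Ioc 0 r, ENNReal.ofReal (t ^ (-(1 / 2) : ℝ))
        = ENNReal.ofReal (2 * r ^ (1 / 2 : ℝ)) := by
    intro r hr
    have hi := (intervalIntegrable_iff_integrableOn_Ioc_of_le hr.le).1
      (intervalIntegral.intervalIntegrable_rpow' (a := 0) (b := r) (r := -(1 / 2)) (by norm_num))
    rw [← ofReal_integral_eq_lintegral_ofReal hi, ← intervalIntegral.integral_of_le hr.le,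
      integral_rpow (Or.inl (by norm_num))]
    · congr 1
      rw [Real.zero_rpow (by norm_num)]
      norm_num
      ring
    · exact (ae_restrict_iff' measurableSet_Ioc).2
        (ae_of_all _ fun t ht => Real.rpow_nonneg ht.1.le _)
  set G : ℝ → ℝ → ℝ≥0∞ := fun t r => (Set.Ioi 0).indicator
    (fun t => (Set.Ioi t).indicator (fun r => ENNReal.ofReal (Real.exp (-r) / √Real.pi) *
      (ENNReal.ofReal (t ^ (-(1 / 2) : ℝ)) * h r)) r) t with hG
  have hGm : Measurable (Function.uncurry G) := by
    have hs : MeasurableSet {q : ℝ × ℝ | 0 < q.1 ∧ q.1 < q.2} :=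
      (measurableSet_lt measurable_const measurable_fst).inter
        (measurableSet_lt measurable_fst measurable_snd)
    have hm : Measurable fun q : ℝ × ℝ => ENNReal.ofReal (Real.exp (-q.2) / √Real.pi) *
      (ENNReal.ofReal (q.1 ^ (-(1 / 2) : ℝ)) * h q.2) := by fun_prop
    convert hm.indicator hs using 1
    ext ⟨t, r⟩
    simp only [Function.uncurry, hG, Set.indicator, Set.mem_Ioi, Set.mem_ofPred_eq]
    split_ifs <;> simp_all
  have hL : ∫⁻ t, ∫⁻ e, h (t + e) ∂(gammaMeasure 1 1) ∂(gammaMeasure (1 / 2) 1)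
      = ∫⁻ t, ∫⁻ r, G t r := by
    rw [lintegral_gammaMeasure, ← lintegral_indicator measurableSet_Ioi]
    congr 1 with t
    by_cases ht : 0 < t
    · simp only [hG, Set.indicator, Set.mem_Ioi, ht, if_true]
      rw [hin t ht, ← lintegral_const_mul' _ _ ENNReal.ofReal_ne_top,
        ← lintegral_indicator measurableSet_Ioi]
      congr 1 with r
      by_cases hr : t < r
      · simp only [Set.indicator, Set.mem_Ioi, hr, if_true]
        rw [← mul_assoc, ← mul_assoc, ← ENNReal.ofReal_mul (by positivity),
          ← ENNReal.ofReal_mul (by positivity), Real.Gamma_one_half_eq]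
        congr 2
        rw [Real.exp_sub, one_mul, Real.one_rpow, Real.exp_neg t, Real.exp_neg r,
          show (1 / 2 : ℝ) - 1 = -(1 / 2) by norm_num]
        field_simp
      · simp [Set.indicator, hr]
    · simp [hG, Set.indicator, ht]
  rw [hL, lintegral_lintegral_swap hGm.aemeasurable, lintegral_gammaMeasure,
    ← lintegral_indicator measurableSet_Ioi]
  congr 1 with r
  by_cases hr : 0 < r
  · have h1 : ∀ t, G t r = (Set.Ioo 0 r).indicator (fun t =>
        (ENNReal.ofReal (Real.exp (-r) / √Real.pi) * h r) *
          ENNReal.ofReal (t ^ (-(1 / 2) : ℝ))) t := by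
      intro t
      simp only [hG, Set.indicator, Set.mem_Ioi, Set.mem_Ioo]
      split_ifs <;> first | ring1 | simp_all
    simp_rw [h1]
    rw [lintegral_indicator measurableSet_Ioo, lintegral_const_mul _ (by fun_prop),
      setLIntegral_congr Ioo_ae_eq_Ioc, hinner r hr]
    simp only [Set.indicator, Set.mem_Ioi, hr, if_true]
    rw [mul_right_comm, ← ENNReal.ofReal_mul (by positivity), Gamma_three_half]
    congr 2
    rw [Real.one_rpow, one_mul, show (3 / 2 : ℝ) - 1 = 1 / 2 by norm_num]
    field_simp
  · simp only [Set.indicator, Set.mem_Ioi, hr, if_false]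
    refine (lintegral_congr fun t => ?_).trans lintegral_zero
    simp only [hG, Set.indicator, Set.mem_Ioi]
    split_ifs with h1 h2
    · exact absurd (h1.trans h2) hr
    · rfl
    · rfl

theorem lintegral_expMoment_gaussianReal {ε : ℝ} (hε : ε < 1 / 2) :
    ∫⁻ z, expMoment ε (z ^ 2 / 2) 1 ∂(gaussianReal 0 1)
      = ENNReal.ofReal (Real.Gamma (3 / 2 - ε) / Real.Gamma (3 / 2)) := by
  rw [lintegral_gaussianReal_half_sq (fun t => expMoment ε t 1)]
  simp only [expMoment, one_mul]
  rw [lintegral_gammaMeasure_one_add (h := fun t => ENNReal.ofReal (t ^ (-ε))) (by fun_prop),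
    lintegral_rpow_gammaMeasure (by norm_num) (by linarith)]
  rfl

/-- With `t = w e / g`, one has `1 - (1 + t) ^ (-ε) ≤ ε log (1 + t) ≤ 4 ε t ^ (1/4)`. The error is
of first order in `ε`, and the power 1/4 keeps `g ^ (-ε - 1/4)` integrable under Gamma(1/2) for `ε <
1/4`. Weakening `w ^ (1/4)` to `w ^ κ` allows a moment of `u` as small as the tail of its limiting
density permits. -/
theorem rpow_neg_le_add {ε w κ g e : ℝ} (hε : 0 ≤ ε) (hw : 0 < w) (hw1 : w ≤ 1) (hκ : κ ≤ 1 / 4)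
    (hg : 0 < g) (he : 0 < e) :
    g ^ (-ε) ≤ (g + w * e) ^ (-ε)
      + 4 * ε * w ^ κ * g ^ (-ε - 1 / 4) * e ^ (1 / 4 : ℝ) := by
  set t := w * e / g with ht
  have ht0 : 0 < t := by positivity
  have h1 : (g + w * e) ^ (-ε) = g ^ (-ε) * (1 + t) ^ (-ε) := by
    rw [← Real.mul_rpow hg.le (by positivity)]
    congr 1
    rw [ht]; field_simp
  have h2 : 1 - ε * Real.log (1 + t) ≤ (1 + t) ^ (-ε) := by
    rw [Real.rpow_def_of_pos (by positivity)]
    have := Real.add_one_le_exp (Real.log (1 + t) * -ε)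
    linarith
  have h3 : Real.log (1 + t) ≤ 4 * t ^ (1 / 4 : ℝ) := by
    have h4 : Real.log (1 + t) = 4 * Real.log ((1 + t) ^ (1 / 4 : ℝ)) := by
      rw [Real.log_rpow (by positivity)]; ring
    have h5 := Real.log_le_sub_one_of_pos (x := (1 + t) ^ (1 / 4 : ℝ)) (by positivity)
    have h6 : (1 + t) ^ (1 / 4 : ℝ) ≤ 1 + t ^ (1 / 4 : ℝ) := by
      have := Real.rpow_add_le_add_rpow zero_le_one ht0.le (p := 1 / 4) (by norm_num) (by norm_num)
      simpa using this
    linarith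
  have h7 : t ^ (1 / 4 : ℝ) ≤ w ^ κ * e ^ (1 / 4 : ℝ) * g ^ (-(1 / 4) : ℝ) := by
    rw [ht, Real.div_rpow (by positivity) hg.le, Real.mul_rpow hw.le he.le, Real.rpow_neg hg.le,
      ← div_eq_mul_inv]
    have : w ^ (1 / 4 : ℝ) ≤ w ^ κ := Real.rpow_le_rpow_of_exponent_ge hw hw1 hκ
    gcongr
  have h8 : g ^ (-ε - 1 / 4) = g ^ (-ε) * g ^ (-(1 / 4) : ℝ) := by
    rw [← Real.rpow_add hg]; rfl
  have h9 : 1 ≤ (1 + t) ^ (-ε) + ε * (4 * (w ^ κ * e ^ (1 / 4 : ℝ) * g ^ (-(1 / 4) : ℝ))) := by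
    have := mul_le_mul_of_nonneg_left (h3.trans (mul_le_mul_of_nonneg_left h7 zero_le_four)) hε
    linarith
  have h10 := mul_le_mul_of_nonneg_left h9 (Real.rpow_nonneg hg.le (-ε))
  rw [h1, h8]
  linarith

theorem ofReal_rpow_le_expMoment_add {ε w κ B : ℝ} (hε : 0 ≤ ε) (hw : 0 < w) (hw1 : w ≤ 1)
    (hκ : κ ≤ 1 / 4) (hB : 0 < B) :
    ENNReal.ofReal (B ^ (-ε)) ≤ expMoment ε B w
      + ENNReal.ofReal (4 * ε * w ^ κ * B ^ (-ε - 1 / 4) * Real.Gamma (5 / 4)) := by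
  have h1 : ENNReal.ofReal (4 * ε * w ^ κ * B ^ (-ε - 1 / 4) * Real.Gamma (5 / 4))
      = ∫⁻ e, ENNReal.ofReal (4 * ε * w ^ κ * B ^ (-ε - 1 / 4) * e ^ (1 / 4 : ℝ))
        ∂(gammaMeasure 1 1) := by
    have h := lintegral_rpow_gammaMeasure (α := 1) (κ := 1 / 4) one_pos (by norm_num)
    rw [Real.Gamma_one, div_one, show (1 : ℝ) + 1 / 4 = 5 / 4 by norm_num] at h
    rw [ENNReal.ofReal_mul (by positivity), ← h, ← lintegral_const_mul' _ _ ENNReal.ofReal_ne_top]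
    exact lintegral_congr fun e => (ENNReal.ofReal_mul (by positivity)).symm
  rw [h1, expMoment, ← lintegral_add_right _ (by fun_prop)]
  calc ENNReal.ofReal (B ^ (-ε)) = ∫⁻ _, ENNReal.ofReal (B ^ (-ε)) ∂(gammaMeasure 1 1) := by
        rw [lintegral_const, measure_univ, mul_one]
    _ ≤ _ := by
      refine lintegral_mono_ae ?_
      filter_upwards [ae_pos_gammaMeasure 1 1] with e he
      rw [← ENNReal.ofReal_add (by positivity) (by positivity)]
      exact ENNReal.ofReal_le_ofReal (rpow_neg_le_add hε hw hw1 hκ hB he)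

section

variable {p : ℕ} {a b c : ℝ} {x : Fin p → ℝ}

theorem lintegral_tauKernel (ha : 0 < a) (hb : 0 < b) (hc : 0 < c) (hx : ∀ k, 1 ≤ x k)
    (hap : a + p / 2 < p) :
    ∫⁻ u in Set.Ioi (0 : ℝ), ENNReal.ofReal
      (tauKernel a b c x 0 u / ∫ t in Set.Ioi (0 : ℝ), tauKernel a b c x 0 t) = 1 := by
  have hI := integrableOn_tauKernel (x := x) ha hb hc hx hap le_rfl
  have hI0 : 0 < ∫ t in Set.Ioi (0 : ℝ), tauKernel a b c x 0 t :=
    setIntegral_Ioi_pos hI fun t ht => tauKernel_pos hc hx le_rfl ht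
  rw [← ofReal_integral_eq_lintegral_ofReal (hI.div_const _), integral_div, div_self hI0.ne',
    ENNReal.ofReal_one]
  refine (ae_restrict_iff' measurableSet_Ioi).2 (ae_of_all _ fun u (hu : 0 < u) => ?_)
  exact div_nonneg (tauKernel_pos hc hx le_rfl hu).le hI0.le

/-- At `s = 0` the kernel has mass one and `u / (x k + u) ≤ 1`, so the worst case is `w = 1`. This
bound serves the block of scales equal to `1`. -/
theorem le_tauMoment (ha : 0 < a) (hb : 0 < b) (hc : 0 < c) (hx : ∀ k, 1 ≤ x k)
    (hap : a + p / 2 < p) {ε B : ℝ} (hε : 0 ≤ ε) (hB : 0 ≤ B) (k : Fin p) :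
    expMoment ε B 1 ≤ tauMoment a b c x k ε 0 B := by
  calc expMoment ε B 1
      = ∫⁻ u in Set.Ioi (0 : ℝ), ENNReal.ofReal
          (tauKernel a b c x 0 u / ∫ t in Set.Ioi (0 : ℝ), tauKernel a b c x 0 t)
          * expMoment ε B 1 := by
        rw [lintegral_mul_const _ (by fun_prop), lintegral_tauKernel ha hb hc hx hap, one_mul]
    _ ≤ _ := by
      refine setLIntegral_mono' measurableSet_Ioi fun u (hu : 0 < u) => ?_
      have hxk := hx k
      gcongr
      refine expMoment_anti hε hB le_rfl (by positivity) ?_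
      rw [div_le_one (by positivity)]
      linarith

theorem le_gaussian_tauMoment (ha : 0 < a) (hb : 0 < b) (hc : 0 < c) (hx : ∀ k, 1 ≤ x k)
    (hap : a + p / 2 < p) {ε : ℝ} (hε : 0 ≤ ε) (hε2 : ε < 1 / 2) (k : Fin p) :
    ENNReal.ofReal (Real.Gamma (3 / 2 - ε) / Real.Gamma (3 / 2))
      ≤ ∫⁻ z, tauMoment a b c x k ε 0 (z ^ 2 / 2) ∂(gaussianReal 0 1) := by
  rw [← lintegral_expMoment_gaussianReal hε2]
  exact lintegral_mono fun z => le_tauMoment ha hb hc hx hap hε (by positivity) k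

theorem ofReal_rpow_le_tauMoment_add (ha : 0 < a) (hb : 0 < b) (hc : 0 < c) (hx : ∀ k, 1 ≤ x k)
    (hap : a + p / 2 < p) {ε B κ η : ℝ} (hε : 0 ≤ ε) (hB : 0 < B) (hκ : κ ≤ 1 / 4) (k : Fin p)
    (hη : ∫⁻ u in Set.Ioi (0 : ℝ), ENNReal.ofReal
      (tauKernel a b c x 0 u / ∫ t in Set.Ioi (0 : ℝ), tauKernel a b c x 0 t)
        * ENNReal.ofReal ((u / (x k + u)) ^ κ) ≤ ENNReal.ofReal η) :
    ENNReal.ofReal (B ^ (-ε)) ≤ tauMoment a b c x k ε 0 B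
      + ENNReal.ofReal (4 * ε * Real.Gamma (5 / 4)) * ENNReal.ofReal η
        * ENNReal.ofReal (B ^ (-ε - 1 / 4)) := by
  have hΓ : 0 < Real.Gamma (5 / 4) := Real.Gamma_pos_of_pos (by norm_num)
  refine le_trans ?_ (add_le_add le_rfl (mul_le_mul_left (mul_le_mul_right hη _) _))
  rw [mul_assoc, mul_comm (lintegral _ _), ← mul_assoc,
    ← lintegral_const_mul' _ _ (ENNReal.mul_ne_top ENNReal.ofReal_ne_top ENNReal.ofReal_ne_top),
    tauMoment, ← lintegral_add_right _ (by fun_prop)]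
  calc ENNReal.ofReal (B ^ (-ε))
      = ∫⁻ u in Set.Ioi (0 : ℝ), ENNReal.ofReal
          (tauKernel a b c x 0 u / ∫ t in Set.Ioi (0 : ℝ), tauKernel a b c x 0 t)
          * ENNReal.ofReal (B ^ (-ε)) := by
        rw [lintegral_mul_const _ (by fun_prop), lintegral_tauKernel ha hb hc hx hap, one_mul]
    _ ≤ _ := by
      refine setLIntegral_mono' measurableSet_Ioi fun u (hu : 0 < u) => ?_
      have hxk := hx k
      rw [mul_left_comm, ← mul_add]
      gcongr
      refine (ofReal_rpow_le_expMoment_add hε (w := u / (x k + u)) (by positivity) ?_ hκ hB).trans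
        (le_of_eq ?_)
      · rw [div_le_one (by positivity)]
        linarith
      · rw [← ENNReal.ofReal_mul (by positivity), ← ENNReal.ofReal_mul (by positivity)]
        congr 2
        ring

theorem ofReal_Gamma_le_gaussian_tauMoment_add (ha : 0 < a) (hb : 0 < b) (hc : 0 < c)
    (hx : ∀ k, 1 ≤ x k) (hap : a + p / 2 < p) {ε κ η : ℝ} (hε : 0 ≤ ε) (hε4 : ε < 1 / 4)
    (hκ : κ ≤ 1 / 4) (hη0 : 0 ≤ η) (k : Fin p)
    (hη : ∫⁻ u in Set.Ioi (0 : ℝ), ENNReal.ofReal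
      (tauKernel a b c x 0 u / ∫ t in Set.Ioi (0 : ℝ), tauKernel a b c x 0 t)
        * ENNReal.ofReal ((u / (x k + u)) ^ κ) ≤ ENNReal.ofReal η) :
    ENNReal.ofReal (Real.Gamma (1 / 2 - ε) / Real.Gamma (1 / 2)
        - 4 * ε * Real.Gamma (5 / 4) * η * (Real.Gamma (1 / 4 - ε) / Real.Gamma (1 / 2)))
      ≤ ∫⁻ z, tauMoment a b c x k ε 0 (z ^ 2 / 2) ∂(gaussianReal 0 1) := by
  have hΓ : 0 < Real.Gamma (5 / 4) := Real.Gamma_pos_of_pos (by norm_num)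
  have hΓ2 : 0 < Real.Gamma (1 / 2) := Real.Gamma_pos_of_pos (by norm_num)
  have hΓ4 : 0 < Real.Gamma (1 / 4 - ε) := Real.Gamma_pos_of_pos (by linarith)
  rw [ENNReal.ofReal_sub _ (by positivity), tsub_le_iff_right,
    lintegral_gaussianReal_half_sq (fun t => tauMoment a b c x k ε 0 t)]
  have h1 := lintegral_rpow_gammaMeasure (α := 1 / 2) (κ := -ε) (by norm_num) (by linarith)
  have h2 := lintegral_rpow_gammaMeasure (α := 1 / 2) (κ := -ε - 1 / 4) (by norm_num) (by linarith)
  rw [← sub_eq_add_neg] at h1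
  rw [show (1 / 2 : ℝ) + (-ε - 1 / 4) = 1 / 4 - ε by ring] at h2
  rw [ENNReal.ofReal_mul (by positivity), ENNReal.ofReal_mul (by positivity), ← h1, ← h2,
    ← lintegral_const_mul' _ _ (ENNReal.mul_ne_top ENNReal.ofReal_ne_top ENNReal.ofReal_ne_top),
    ← lintegral_add_right _ (by fun_prop)]
  refine lintegral_mono_ae ?_
  filter_upwards [ae_pos_gammaMeasure (1 / 2) 1] with t ht
  exact ofReal_rpow_le_tauMoment_add ha hb hc hx hap hε ht hκ k hη

end

/-! ### Two blocks of local scales -/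

/-- The vector with the first `m` coordinates equal to `1` and the others equal to `K`. -/
def blockScale (p m : ℕ) (K : ℝ) (k : Fin p) : ℝ := if (k : ℕ) < m then 1 else K

theorem one_le_blockScale {p m : ℕ} {K : ℝ} (hK : 1 ≤ K) (k : Fin p) : 1 ≤ blockScale p m K k := by
  unfold blockScale
  split_ifs <;> simp [hK]

theorem blockScale_le {p m : ℕ} {K : ℝ} (hK : 1 ≤ K) (k : Fin p) : blockScale p m K k ≤ K := by
  unfold blockScale
  split_ifs <;> simp [hK]

theorem sum_blockScale {p m : ℕ} (hm : m ≤ p) (f g : ℝ) :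
    ∑ k : Fin p, (if (k : ℕ) < m then f else g) = m * f + (p - m) * g := by
  have h : (Finset.univ.filter fun k : Fin p => (k : ℕ) < m).card = m := by
    rw [Fin.card_filter_val_lt, min_eq_right hm]
  have h2 := Finset.card_filter_add_card_filter_not (s := (Finset.univ : Finset (Fin p)))
    fun k : Fin p => (k : ℕ) < m
  rw [h, Finset.card_univ, Fintype.card_fin] at h2
  have h3 : ((Finset.univ.filter fun k : Fin p => ¬ (k : ℕ) < m).card : ℝ) = p - m := by
    rw [← h2, Nat.cast_add, add_sub_cancel_left]
    congr!
  rw [Finset.sum_ite, Finset.sum_const, Finset.sum_const, nsmul_eq_mul, nsmul_eq_mul, h, h3]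

theorem prod_mul_pow_le {p m : ℕ} (hm : m ≤ p) {K u : ℝ} (hK : 1 ≤ K) (hu : 0 < u) :
    (∏ k, blockScale p m K k) * (1 + u) ^ m ≤ ∏ k, (blockScale p m K k + u) := by
  have h : ∏ k : Fin p, (if (k : ℕ) < m then 1 + u else 1) = (1 + u) ^ m := by
    rw [Finset.prod_ite, Finset.prod_const, Finset.prod_const_one, mul_one,
      Fin.card_filter_val_lt, min_eq_right hm]
  rw [← h, ← Finset.prod_mul_distrib]
  refine Finset.prod_le_prod (fun k _ => ?_) fun k _ => ?_
  · have := one_le_blockScale (m := m) hK k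
    split_ifs <;> positivity
  · unfold blockScale
    split_ifs <;> linarith

theorem prod_le_mul_pow {p m : ℕ} {K u : ℝ} (hK : 1 ≤ K) (hu : 0 < u) :
    ∏ k, (blockScale p m K k + u) ≤ (∏ k, blockScale p m K k) * (1 + u) ^ p := by
  have h : ∏ _k : Fin p, (1 + u) = (1 + u) ^ p := by simp
  rw [← h, ← Finset.prod_mul_distrib]
  refine Finset.prod_le_prod (fun k _ => ?_) fun k _ => ?_
  · have := one_le_blockScale (m := m) hK k
    positivity
  · have := one_le_blockScale (m := m) hK k
    nlinarith

/-- On the large block, `K + u ≥ K` bounds the kernel above and `K + u ≤ K (1 + u)` bounds its mass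
below. The same product of scales appears in both and cancels, so `K` survives only through `(u / (K
+ u)) ^ κ ≤ u ^ κ * K ^ (-κ)`. -/
theorem lintegral_blockScale_le {p m : ℕ} {a b c κ K : ℝ} (hm : m ≤ p) (ha : 0 < a) (hb : 0 < b)
    (hc : 0 < c) (hκ : 0 < κ) (hap : a + p / 2 < p) (haκ : a + p / 2 + κ < m) (hK : 1 ≤ K) :
    ∫⁻ u in Set.Ioi (0 : ℝ), ENNReal.ofReal (tauKernel a b c (blockScale p m K) 0 u /
        ∫ t in Set.Ioi (0 : ℝ), tauKernel a b c (blockScale p m K) 0 t)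
        * ENNReal.ofReal ((u / (K + u)) ^ κ)
      ≤ ENNReal.ofReal (K ^ (-κ) *
        ((∫ u in Set.Ioi (0 : ℝ), u ^ (a + p / 2 + κ - 1) / (1 + u) ^ (m : ℝ)) /
          ∫ u in Set.Ioi (0 : ℝ), u ^ (a + p / 2 - 1) / (1 + u) ^ (p : ℝ))) := by
  have hx := one_le_blockScale (p := p) (m := m) hK
  set x := blockScale p m K with hxdef
  have hα : 0 < a + p / 2 := by positivity
  have hK0 : 0 < K := one_pos.trans_le hK
  set A := (c ^ (a + b))⁻¹ * (∏ k, x k)⁻¹ with hA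
  have hpx : 0 < ∏ k, x k := Finset.prod_pos fun k _ => one_pos.trans_le (hx k)
  have hA0 : 0 < A := by positivity
  have hI1 := integrableOn_rpow_div_add_rpow (α := a + p / 2 + κ) (by positivity) haκ one_pos
  have hI2 := integrableOn_rpow_div_add_rpow (α := a + p / 2) hα hap one_pos
  have hI2' := setIntegral_Ioi_pos hI2 fun t ht => by positivity
  have hZ : A * (∫ u in Set.Ioi (0 : ℝ), u ^ (a + p / 2 - 1) / (1 + u) ^ (p : ℝ))
      ≤ ∫ t in Set.Ioi (0 : ℝ), tauKernel a b c x 0 t := by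
    rw [← integral_const_mul]
    refine setIntegral_mono_on (hI2.const_mul A)
      (integrableOn_tauKernel ha hb hc hx hap le_rfl) measurableSet_Ioi fun u (hu : 0 < u) => ?_
    have hp : 0 < ∏ k, (x k + u) := Finset.prod_pos fun k _ => by linarith [hx k]
    have := prod_le_mul_pow (p := p) (m := m) hK hu
    rw [Real.rpow_natCast]
    calc A * (u ^ (a + p / 2 - 1) / (1 + u) ^ p)
        = u ^ (a + p / 2 - 1) / c ^ (a + b) / ((∏ k, x k) * (1 + u) ^ p) := by
          rw [hA]; field_simp
      _ ≤ u ^ (a + p / 2 - 1) / c ^ (a + b) / ∏ k, (x k + u) := by gcongr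
      _ = _ := by simp [tauKernel]
  set Z := ∫ t in Set.Ioi (0 : ℝ), tauKernel a b c x 0 t
  set I₁ := ∫ u in Set.Ioi (0 : ℝ), u ^ (a + p / 2 + κ - 1) / (1 + u) ^ (m : ℝ) with hI₁
  set I₂ := ∫ u in Set.Ioi (0 : ℝ), u ^ (a + p / 2 - 1) / (1 + u) ^ (p : ℝ)
  have hZ0 : 0 < Z := (mul_pos hA0 hI2').trans_le hZ
  have hI10 : 0 ≤ I₁ := setIntegral_nonneg measurableSet_Ioi fun u (hu : 0 < u) => by positivity
  calc _ ≤ ∫⁻ u in Set.Ioi (0 : ℝ), ENNReal.ofReal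
        (A / Z * K ^ (-κ) * (u ^ (a + p / 2 + κ - 1) / (1 + u) ^ (m : ℝ))) := by
        refine setLIntegral_mono' measurableSet_Ioi fun u (hu : 0 < u) => ?_
        have hp : 0 < ∏ k, (x k + u) := Finset.prod_pos fun k _ => by linarith [hx k]
        rw [← ENNReal.ofReal_mul (div_nonneg (tauKernel_pos hc hx le_rfl hu).le hZ0.le)]
        refine ENNReal.ofReal_le_ofReal ?_
        have h1 : tauKernel a b c x 0 u ≤ A * (u ^ (a + p / 2 - 1) / (1 + u) ^ (m : ℝ)) := by
          have := prod_mul_pow_le (p := p) hm hK hu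
          rw [Real.rpow_natCast]
          calc tauKernel a b c x 0 u
              = u ^ (a + p / 2 - 1) / c ^ (a + b) / ∏ k, (x k + u) := by simp [tauKernel]
            _ ≤ u ^ (a + p / 2 - 1) / c ^ (a + b) / ((∏ k, x k) * (1 + u) ^ m) := by gcongr
            _ = _ := by rw [hA]; field_simp
        have h2 : (u / (K + u)) ^ κ ≤ u ^ κ * K ^ (-κ) := by
          rw [Real.rpow_neg hK0.le, ← div_eq_mul_inv, ← Real.div_rpow hu.le hK0.le]
          have : K ≤ K + u := by linarith
          gcongr
        have h3 : u ^ (a + p / 2 + κ - 1) = u ^ (a + p / 2 - 1) * u ^ κ := by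
          rw [← Real.rpow_add hu]; ring_nf
        calc tauKernel a b c x 0 u / Z * (u / (K + u)) ^ κ
            ≤ A * (u ^ (a + p / 2 - 1) / (1 + u) ^ (m : ℝ)) / Z * (u ^ κ * K ^ (-κ)) := by
              gcongr
          _ = _ := by rw [h3]; ring
    _ = ENNReal.ofReal (A / Z * K ^ (-κ) * I₁) := by
        rw [hI₁, ← integral_const_mul, ofReal_integral_eq_lintegral_ofReal (hI1.const_mul _)]
        exact (ae_restrict_iff' measurableSet_Ioi).2
          (ae_of_all _ fun u (hu : 0 < u) => by positivity)
    _ ≤ _ := by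
        refine ENNReal.ofReal_le_ofReal ?_
        have h1 : A / Z ≤ 1 / I₂ := by
          rw [div_le_div_iff₀ hZ0 hI2', one_mul]
          exact hZ
        calc A / Z * K ^ (-κ) * I₁ ≤ 1 / I₂ * K ^ (-κ) * I₁ := by gcongr
          _ = _ := by ring

theorem exists_lintegral_blockScale_le {p m : ℕ} {a b c κ η : ℝ} (hm : m ≤ p) (ha : 0 < a)
    (hb : 0 < b) (hc : 0 < c) (hκ : 0 < κ) (hap : a + p / 2 < p) (haκ : a + p / 2 + κ < m)
    (hη : 0 < η) : ∃ K : ℝ, 1 ≤ K ∧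
    ∫⁻ u in Set.Ioi (0 : ℝ), ENNReal.ofReal (tauKernel a b c (blockScale p m K) 0 u /
        ∫ t in Set.Ioi (0 : ℝ), tauKernel a b c (blockScale p m K) 0 t)
        * ENNReal.ofReal ((u / (K + u)) ^ κ) ≤ ENNReal.ofReal η := by
  have h := (tendsto_rpow_neg_atTop hκ).mul_const
    ((∫ u in Set.Ioi (0 : ℝ), u ^ (a + p / 2 + κ - 1) / (1 + u) ^ (m : ℝ)) /
          ∫ u in Set.Ioi (0 : ℝ), u ^ (a + p / 2 - 1) / (1 + u) ^ (p : ℝ))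
  rw [zero_mul] at h
  obtain ⟨K, hK1, hK2⟩ := ((h.eventually (gt_mem_nhds hη)).and
    (Filter.eventually_ge_atTop (1 : ℝ))).exists
  exact ⟨K, hK2, (lintegral_blockScale_le hm ha hb hc hκ hap haκ hK2).trans
    (ENNReal.ofReal_le_ofReal hK1.le)⟩

/-! ### The first order expansion in `ε` -/

theorem Gamma_three_half_sub {ε : ℝ} (hε : ε < 1 / 2) :
    Real.Gamma (3 / 2 - ε) / Real.Gamma (3 / 2)
      = (1 - 2 * ε) * (Real.Gamma (1 / 2 - ε) / Real.Gamma (1 / 2)) := by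
  rw [Gamma_three_half, Real.Gamma_one_half_eq, show 3 / 2 - ε = (1 / 2 - ε) + 1 by ring,
    Real.Gamma_add_one (by linarith)]
  have := (Real.sqrt_pos.2 Real.pi_pos).ne'
  field_simp

/-- The logarithmic derivative is `ψ(1) - ψ(1/2)`, in which Euler's constant cancels. -/
theorem hasDerivAt_Gamma_mul_Gamma :
    HasDerivAt (fun ε => Real.Gamma (1 + ε) * (Real.Gamma (1 / 2 - ε) / Real.Gamma (1 / 2)))
      (2 * Real.log 2) 0 := by
  have h1 : HasDerivAt (fun ε => Real.Gamma (1 + ε)) (-Real.eulerMascheroniConstant) 0 := by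
    have h : HasDerivAt Real.Gamma (-Real.eulerMascheroniConstant) (1 + 0) := by
      simpa using Real.hasDerivAt_Gamma_one
    exact h.comp_const_add 1 0
  have h2 : HasDerivAt (fun ε => Real.Gamma (1 / 2 - ε))
      (-(-√Real.pi * (Real.eulerMascheroniConstant + 2 * Real.log 2))) 0 := by
    have h : HasDerivAt Real.Gamma
        (-√Real.pi * (Real.eulerMascheroniConstant + 2 * Real.log 2)) (1 / 2 - 0) := by
      simpa using Real.hasDerivAt_Gamma_one_half
    exact h.comp_const_sub (1 / 2) 0
  have h3 := h1.mul (h2.div_const (Real.Gamma (1 / 2)))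
  refine h3.congr_deriv ?_
  have := (Real.sqrt_pos.2 Real.pi_pos).ne'
  simp only [add_zero, sub_zero, Real.Gamma_one, Real.Gamma_one_half_eq]
  field_simp
  ring

/-- The function is the lower bound for the limiting energy minus `M + N * K ^ (-ε)`. Each bracket
vanishes at `0`, so the derivative of `K ^ (-ε)` drops out and `K` does not enter the slope; `r`
carries the error from `w ≠ 0`. -/
theorem hasDerivAt_blockMoment (M N K r : ℝ) (hK : 0 < K) :
    HasDerivAt (fun ε => M * (Real.Gamma (1 + ε) *
        ((1 - 2 * ε) * (Real.Gamma (1 / 2 - ε) / Real.Gamma (1 / 2))) - 1)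
      + N * (K ^ (-ε) * (Real.Gamma (1 + ε) * (Real.Gamma (1 / 2 - ε) / Real.Gamma (1 / 2)
        - ε * r * Real.Gamma (1 / 4 - ε)) - 1)))
      (M * (2 * Real.log 2 - 2) + N * (2 * Real.log 2 - r * Real.Gamma (1 / 4))) 0 := by
  have hD := hasDerivAt_Gamma_mul_Gamma
  set D : ℝ → ℝ := fun ε =>
    Real.Gamma (1 + ε) * (Real.Gamma (1 / 2 - ε) / Real.Gamma (1 / 2)) with hDdef
  have hD0 : D 0 = 1 := by
    simp only [hDdef, add_zero, sub_zero, Real.Gamma_one, one_mul]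
    exact div_self (Real.Gamma_pos_of_pos (by norm_num)).ne'
  have hΓ1 : DifferentiableAt ℝ (fun ε => Real.Gamma (1 + ε)) 0 :=
    DifferentiableAt.comp (g := Real.Gamma) (0 : ℝ) (Real.differentiableAt_Gamma fun m => by
      have : (0 : ℝ) ≤ m := m.cast_nonneg
      linarith) (by fun_prop)
  have hΓ4 : DifferentiableAt ℝ (fun ε => Real.Gamma (1 / 4 - ε)) 0 :=
    DifferentiableAt.comp (g := Real.Gamma) (0 : ℝ) (Real.differentiableAt_Gamma fun m => by
      have : (0 : ℝ) ≤ m := m.cast_nonneg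
      linarith) (by fun_prop)
  have hid := hasDerivAt_id (0 : ℝ)
  have h1 : HasDerivAt (fun ε => (1 - 2 * ε) * D ε - 1) (2 * Real.log 2 - 2) 0 := by
    have h := (((hid.const_mul 2).const_sub 1).mul hD).sub_const 1
    refine h.congr_deriv ?_
    simp only [id, hD0]
    ring
  have h2 : HasDerivAt (fun ε => ε * (r * (Real.Gamma (1 + ε) * Real.Gamma (1 / 4 - ε))))
      (r * Real.Gamma (1 / 4)) 0 := by
    have h := hid.mul ((hΓ1.mul hΓ4).const_mul r).hasDerivAt
    refine h.congr_deriv ?_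
    simp
  have h3 : HasDerivAt (fun ε : ℝ => K ^ (-ε)) (Real.log K * -1 * K ^ (-(0 : ℝ))) 0 :=
    (hasDerivAt_neg (0 : ℝ)).const_rpow hK
  have h4 := h3.mul ((hD.sub h2).sub_const 1)
  have h5 := (h1.const_mul M).add (h4.const_mul N)
  refine (h5.congr_of_eventuallyEq (.of_forall fun ε => ?_)).congr_deriv ?_
  · simp only [hDdef, Pi.add_apply, Pi.mul_apply, Pi.sub_apply]
    ring
  · simp [hD0]

theorem exists_forall_pos_of_hasDerivAt {f : ℝ → ℝ} {d : ℝ} (hf : HasDerivAt f d 0) (hd : 0 < d)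
    (h0 : f 0 = 0) : ∃ ε₀ > 0, ∀ ε, 0 < ε → ε < ε₀ → 0 < f ε := by
  have h := (hasDerivAt_iff_tendsto_slope.1 hf).eventually (lt_mem_nhds hd)
  rw [eventually_nhdsWithin_iff, Metric.eventually_nhds_iff] at h
  obtain ⟨ε₀, hε₀, h⟩ := h
  refine ⟨ε₀, hε₀, fun ε hε hlt => ?_⟩
  have h1 := h (y := ε) (by simpa [abs_of_pos hε] using hlt) hε.ne'
  rw [slope_def_field, h0, sub_zero, sub_zero] at h1
  exact (div_pos_iff_of_pos_right hε).1 h1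

/-! ### Failure of the drift condition -/

open Filter Topology in
theorem exists_limit_le_of_driftCondition {n p : ℕ} (X : Matrix (Fin n) (Fin p) ℝ)
    (y : Fin n → ℝ) {a b c aσ bσ ε K : ℝ} {x : Fin p → ℝ} (ha : 0 < a) (hb : 0 < b) (hc : 0 < c)
    (haσ : 0 < aσ) (hbσ : 0 < bσ) (hε : 0 < ε) (hap : a + p / 2 < p) (hx : ∀ k, 1 ≤ x k)
    (hxK : ∀ k, x k ≤ K) (h : DriftCondition (transitionOp X y a b c aσ bσ) (energy ε)) :
    ∃ δ : ℝ, 0 < δ ∧ δ < 1 ∧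
      ∑ k, ENNReal.ofReal (Real.Gamma (1 + ε)) * ENNReal.ofReal (x k ^ (-ε)) *
          ∫⁻ z, tauMoment a b c x k ε 0 (z ^ 2 / 2) ∂(gaussianReal 0 1)
        ≤ ENNReal.ofReal (δ * ∑ k, x k ^ (-ε)) := by
  obtain ⟨δ, Δ, hδ0, hδ1, -, hdrift⟩ := h
  refine ⟨δ, hδ0, hδ1, ?_⟩
  have hα : 0 < (n : ℝ) / 2 + aσ := by positivity
  set C := K * √((Xᵀ *ᵥ y) ⬝ᵥ (Xᵀ *ᵥ y)) with hC
  set s : ℕ → ℝ := fun j => 1 / ((j : ℝ) + 1) with hs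
  have hs0 : ∀ j, 0 < s j := fun j => by positivity
  have hslim : Tendsto s atTop (𝓝 0) := tendsto_one_div_add_atTop_nhds_zero_nat
  set S : Fin p → ℕ → ℝ≥0∞ := fun k j => ∫⁻ g, ∫⁻ z, tauMoment a b c x k ε (s j)
          ((C * √(s j) * √(g / bσ) + |z|) ^ 2 / 2) ∂(gaussianReal 0 1)
            ∂(gammaMeasure ((n : ℝ) / 2 + aσ) 1) with hS
  -- The drift inequality at `s j * x`, multiplied by `s j ^ ε`: the `Δ` term now tends to zero.
  have hbound : ∀ j, ∑ k, ENNReal.ofReal (Real.Gamma (1 + ε)) * ENNReal.ofReal (x k ^ (-ε)) * S k j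
      ≤ ENNReal.ofReal (s j ^ ε * Δ + δ * ∑ k, x k ^ (-ε)) := by
    intro j
    have hv : ∀ k, 0 < s j * x k := fun k => mul_pos (hs0 j) (one_pos.trans_le (hx k))
    have h1 := (sum_le_transitionOp X y a b c aσ bσ (ε := ε) (by linarith) hv).trans (hdrift _ hv)
    have h2 : ∀ k, s j ^ ε * (s j * x k) ^ (-ε) = x k ^ (-ε) := fun k => by
      rw [Real.mul_rpow (hs0 j).le (by linarith [hx k]), Real.rpow_neg (hs0 j).le,
        mul_inv_cancel_left₀ (Real.rpow_pos_of_pos (hs0 j) ε).ne']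
    calc ∑ k, ENNReal.ofReal (Real.Gamma (1 + ε)) * ENNReal.ofReal (x k ^ (-ε)) * S k j
        = ENNReal.ofReal (s j ^ ε) * ∑ k, ENNReal.ofReal (Real.Gamma (1 + ε)) *
            (ENNReal.ofReal ((s j * x k) ^ (-ε)) * S k j) := by
          rw [Finset.mul_sum]
          refine Finset.sum_congr rfl fun k _ => ?_
          have := hs0 j
          rw [← h2 k, ENNReal.ofReal_mul (by positivity)]
          ring
      _ ≤ ENNReal.ofReal (s j ^ ε) * ENNReal.ofReal (Δ + δ * energy ε fun k => s j * x k) := by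
          gcongr
          refine le_trans (Finset.sum_le_sum fun k _ => ?_) h1
          gcongr
          exact le_firstStep X y ha hb hc hbσ hε.le hx hxK hap (hs0 j) k
      _ = _ := by
          have := hs0 j
          rw [← ENNReal.ofReal_mul (by positivity), mul_add, energy, mul_left_comm (s j ^ ε) δ,
            Finset.mul_sum]
          congr 3
          refine Finset.sum_congr rfl fun k _ => ?_
          rw [← h2 k, one_div, Real.rpow_neg (hv k).le]
  have hlim : Tendsto (fun j => ENNReal.ofReal (s j ^ ε * Δ + δ * ∑ k, x k ^ (-ε))) atTop
      (𝓝 (ENNReal.ofReal (δ * ∑ k, x k ^ (-ε)))) := by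
    refine ENNReal.tendsto_ofReal ?_
    have h1 : Tendsto (fun j => s j ^ ε) atTop (𝓝 (0 ^ ε)) := hslim.rpow_const (Or.inr hε.le)
    rw [Real.zero_rpow hε.ne'] at h1
    simpa using (h1.mul_const Δ).add_const (δ * ∑ k, x k ^ (-ε))
  rw [← hlim.liminf_eq]
  refine le_trans ?_ (liminf_le_liminf (Eventually.of_forall hbound))
  -- The finite sum over `k` is an integral against counting measure, so Fatou moves the lower limit
  -- outside it.
  have hcount := lintegral_le_liminf (μ := (Measure.count : Measure (Fin p)))
    (A := fun j k => ENNReal.ofReal (Real.Gamma (1 + ε)) * ENNReal.ofReal (x k ^ (-ε)) * S k j)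
    (A₀ := fun k => ENNReal.ofReal (Real.Gamma (1 + ε)) * ENNReal.ofReal (x k ^ (-ε)) *
          ∫⁻ z, tauMoment a b c x k ε 0 (z ^ 2 / 2) ∂(gaussianReal 0 1))
    (fun j => measurable_from_top) (ae_of_all _ fun k => by
      rw [ENNReal.liminf_const_mul_of_ne_top
        (ENNReal.mul_ne_top ENNReal.ofReal_ne_top ENNReal.ofReal_ne_top)]
      gcongr
      exact gaussian_tauMoment_le_liminf hc hx k hα hslim)
  simpa only [lintegral_count, tsum_fintype] using hcount

theorem not_driftCondition {n p m : ℕ} (X : Matrix (Fin n) (Fin p) ℝ) (y : Fin n → ℝ)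
    {a b c aσ bσ : ℝ} (ha : 0 < a) (hb : 0 < b) (hc : 0 < c) (haσ : 0 < aσ) (hbσ : 0 < bσ)
    (ham : a + p / 2 < m) (hmp : (m : ℝ) < p * Real.log 2) :
    ∃ ε₀ : ℝ, 0 < ε₀ ∧ ε₀ < 1 / 2 ∧ ∀ ε : ℝ, 0 < ε → ε < ε₀ →
      ¬ DriftCondition (transitionOp X y a b c aσ bσ) (energy ε) := by
  have hlog : Real.log 2 < 1 := by linarith [Real.log_two_lt_d9]
  have hm0 : (0 : ℝ) < m := lt_trans (by positivity) ham
  have hlog0 : 0 < Real.log 2 := Real.log_pos one_lt_two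
  have hp0 : (0 : ℝ) < p := pos_of_mul_pos_left (hm0.trans hmp) hlog0.le
  have hmp' : (m : ℝ) < p := hmp.trans (by nlinarith)
  have hm : m ≤ p := by exact_mod_cast hmp'.le
  have hap : a + p / 2 < p := ham.trans hmp'
  have hΓ2 : 0 < Real.Gamma (1 / 2) := Real.Gamma_pos_of_pos (by norm_num)
  have hΓ4 : 0 < Real.Gamma (1 / 4) := Real.Gamma_pos_of_pos (by norm_num)
  have hΓ5 : 0 < Real.Gamma (5 / 4) := Real.Gamma_pos_of_pos (by norm_num)
  -- At most half the slack in `a + p / 2 < m`, so that the moment of order `κ` of the dominating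
  -- density is finite.
  set κ : ℝ := min (1 / 4) ((m - (a + p / 2)) / 2) with hκdef
  have hκ : 0 < κ := lt_min (by norm_num) (by linarith)
  have haκ : a + p / 2 + κ < m := by
    have := min_le_right (1 / 4 : ℝ) ((m - (a + p / 2)) / 2)
    linarith
  -- Chosen so that `r * Γ(1/4) = (p log 2 - m) / p`; over the `p - m` large scales the error then
  -- uses at most half of the gain `2 (p log 2 - m)`.
  set η : ℝ := (p * Real.log 2 - m) / p * (Real.Gamma (1 / 2) /
    (4 * Real.Gamma (5 / 4) * Real.Gamma (1 / 4))) with hη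
  have hη0 : 0 < η := mul_pos (div_pos (by linarith) hp0) (by positivity)
  obtain ⟨K, hK1, hK⟩ := exists_lintegral_blockScale_le hm ha hb hc hκ hap haκ hη0
  have hK0 : 0 < K := one_pos.trans_le hK1
  set r : ℝ := 4 * Real.Gamma (5 / 4) * η / Real.Gamma (1 / 2) with hr
  have hrΓ : r * Real.Gamma (1 / 4) = (p * Real.log 2 - m) / p := by
    rw [hr, hη]; field_simp
  have hpos : 0 < (m : ℝ) * (2 * Real.log 2 - 2)
      + (p - m) * (2 * Real.log 2 - r * Real.Gamma (1 / 4)) := by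
    have h1 : (p - m : ℝ) * ((p * Real.log 2 - m) / p) ≤ p * Real.log 2 - m := by
      rw [mul_div_assoc', div_le_iff₀ hp0, mul_comm]
      exact mul_le_mul_of_nonneg_left (by linarith) (by linarith)
    rw [hrΓ]
    nlinarith
  obtain ⟨ε₀, hε₀, hφ⟩ := exists_forall_pos_of_hasDerivAt
    (hasDerivAt_blockMoment m (p - m) K r hK0) hpos 
    (by simp [div_self hΓ2.ne', -one_div])
  refine ⟨min ε₀ (1 / 4), lt_min hε₀ (by norm_num), (min_le_right _ _).trans_lt (by norm_num),
    fun ε hε hlt hdrift => ?_⟩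
  have hε4 : ε < 1 / 4 := hlt.trans_le (min_le_right _ _)
  have hφε := hφ ε hε (hlt.trans_le (min_le_left _ _))
  have hx := one_le_blockScale (p := p) (m := m) hK1
  obtain ⟨δ, hδ0, hδ1, hle⟩ := exists_limit_le_of_driftCondition X y ha hb hc haσ hbσ hε hap hx
    (blockScale_le hK1) hdrift
  set A := Real.Gamma (1 + ε) * ((1 - 2 * ε) * (Real.Gamma (1 / 2 - ε) / Real.Gamma (1 / 2)))
    with hA
  set B := Real.Gamma (1 + ε) * (Real.Gamma (1 / 2 - ε) / Real.Gamma (1 / 2)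
        - ε * r * Real.Gamma (1 / 4 - ε)) with hB
  have hΓε : 0 < Real.Gamma (1 + ε) := Real.Gamma_pos_of_pos (by linarith)
  have hterm : ∀ k : Fin p, ENNReal.ofReal (if (k : ℕ) < m then A else K ^ (-ε) * B)
      ≤ ENNReal.ofReal (Real.Gamma (1 + ε)) * ENNReal.ofReal (blockScale p m K k ^ (-ε)) *
          ∫⁻ z, tauMoment a b c (blockScale p m K) k ε 0 (z ^ 2 / 2) ∂(gaussianReal 0 1) := by
    intro k
    by_cases hk : (k : ℕ) < m
    · have h1 := le_gaussian_tauMoment ha hb hc hx hap hε.le (by linarith) k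
      rw [Gamma_three_half_sub (by linarith)] at h1
      have h2 : blockScale p m K k = 1 := if_pos hk
      rw [if_pos hk, h2, Real.one_rpow, ENNReal.ofReal_one, mul_one, hA,
        ENNReal.ofReal_mul hΓε.le]
      gcongr
    · have h2 : blockScale p m K k = K := if_neg hk
      have h1 := ofReal_Gamma_le_gaussian_tauMoment_add ha hb hc hx hap hε.le hε4
        (min_le_left _ _) hη0.le k (by rw [h2]; exact hK)
      rw [if_neg hk, h2, ← ENNReal.ofReal_mul hΓε.le,
        show K ^ (-ε) * B = Real.Gamma (1 + ε) * K ^ (-ε) * (Real.Gamma (1 / 2 - ε) /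
          Real.Gamma (1 / 2) - 4 * ε * Real.Gamma (5 / 4) * η *
            (Real.Gamma (1 / 4 - ε) / Real.Gamma (1 / 2))) by rw [hB, hr]; ring,
        ENNReal.ofReal_mul (by positivity)]
      gcongr
  have hsum : ∑ k, blockScale p m K k ^ (-ε) = m * 1 + (p - m) * K ^ (-ε) := by
    rw [← sum_blockScale hm]
    refine Finset.sum_congr rfl fun k _ => ?_
    unfold blockScale
    split_ifs <;> simp
  have hT : 0 < ∑ k, blockScale p m K k ^ (-ε) := by
    have := Real.rpow_pos_of_pos hK0 (-ε)
    rw [hsum]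
    nlinarith
  have hle2 : ENNReal.ofReal (m * A + (p - m) * (K ^ (-ε) * B))
      ≤ ENNReal.ofReal (δ * ∑ k, blockScale p m K k ^ (-ε)) := by
    rw [← sum_blockScale hm]
    refine le_trans ?_ ((Finset.sum_le_sum fun k _ => hterm k).trans hle)
    -- `B` has not been shown nonnegative; subadditivity of `ENNReal.ofReal` holds without that.
    exact Finset.le_sum_of_subadditive _ ENNReal.ofReal_zero.le
      (fun _ _ => ENNReal.ofReal_add_le) _ _
  rw [ENNReal.ofReal_le_ofReal_iff (by positivity)] at hle2
  have h3 : δ * ∑ k, blockScale p m K k ^ (-ε) ≤ ∑ k, blockScale p m K k ^ (-ε) := by nlinarith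
  rw [hsum] at h3 hle2
  linarith

end HorseshoeGibbs

theorem propositionS1 {n p : ℕ} (X : Matrix (Fin n) (Fin p) ℝ) (y : Fin n → ℝ)
    (a b c aσ bσ : ℝ) (ha : 0 < a) (hb : 0 < b) (hc : 0 < c) (haσ : 0 < aσ) (hbσ : 0 < bσ)
    (heven : Even p → ∀ m : ℕ, a ≠ (m : ℝ))
    (hodd : Odd p → ∀ m : ℕ, a ≠ (m : ℝ) - 1 / 2)
    (hap : a + 1 < ((2 * Real.log 2 - 1) / 2) * (p : ℝ)) :
    ∃ ε₀ : ℝ, 0 < ε₀ ∧ ε₀ < 1 / 2 ∧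
      ∀ ε₁ : ℝ, 0 < ε₁ → ε₁ < ε₀ →
        ¬ HorseshoeGibbs.DriftCondition
            (HorseshoeGibbs.transitionOp X y a b c aσ bσ)
            (HorseshoeGibbs.energy ε₁) := by
  -- The least integer strictly above `a + p / 2`; it is at most `a + p / 2 + 1`, which the
  -- hypothesis places below `p log 2`.
  refine HorseshoeGibbs.not_driftCondition (m := ⌊a + p / 2⌋₊ + 1) X y ha hb hc haσ hbσ ?_ ?_
  · exact_mod_cast Nat.lt_floor_add_one (a + p / 2 : ℝ)
  · have := Nat.floor_le (a := a + p / 2) (by positivity)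
    push_cast
    linarith
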